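/- Let $N\ge 1$, let $r_1>r_2>\dots>r_N>0$, let $\sigma_0=1$ and let $\sigma_1,\dots,\sigma_N>0$ satisfy $\sigma_k\ne\sigma_{k-1}$ for $1\le k\le N$. In $\mathbb R^2$, with polar coordinates $x=(r\cos\theta,r\sin\theta)$, put $$A_0=\{r>r_1\},\qquad A_k=\{r_{k+1}<r\le r_k\}\ (1\le k\le N-1),\qquad A_N=\{r\le r_N\},\qquad \Gamma_k=\{r=r_k\},$$ and let $\gamma=\sigma_k$ on $A_k$ for $0\le k\le N$. Let $(a_n)_{n\ge1}$ be complex numbers such that $$H=\sum_{n=1}^{\infty}a_n r^n e^{\mathrm i n\theta}$$ converges at every point of $\mathbb R^2$. Consider the conductivity problem for $u\in H^1_{\rm loc}(\mathbb R^2;\mathbb C)$, $$\nabla\cdot(\gamma\nabla u)=0\ \text{ in }\mathbb R^2\ \text{(in the weak sense)},\qquad u-H=O(|x|^{-1})\ \text{ as }|x|\to\infty, \tag{1}$$ and the transmission conditions, with $\nu$ the outward normal and $w|_\pm(x)=\lim_{h\to0^+}w(x\pm h\nu)$, $$u|_+=u|_-,\qquad \sigma_{k-1}\frac{\partial u}{\partial\nu}\Big|_+=\sigma_k\frac{\partial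 u}{\partial\nu}\Big|_-\quad\text{on }\Gamma_k,\quad 1\le k\le N. \tag{2}$$ Put $\lambda_k=\dfrac{\sigma_k+\sigma_{k-1}}{2(\sigma_k-\sigma_{k-1})}$. For $n\ge1$ let $\mathbb M_N^{(n)}$ (the generalized polarization matrix of order $n$) be the $N\times N$ matrix with diagonal entries $-2\lambda_i$, entries $(r_j/r_i)^{2n}$ for $i<j$, and entries $-1$ for $i>j$. Let $\Upsilon_N^{(n)}=\mathrm{diag}(r_1^{2n},\dots,r_N^{2n})$ and $\boldsymbol e=(1,\dots,1)^T\in\mathbb R^N$. Then $\mathbb M_N^{(n)}$ is invertible for every $n\ge1$. The problem (1) has a solution $u$ that is continuous on $\mathbb R^2$ and satisfies (2), and every solution of (1) equals $u$ almost everywhere. For every $x$ with $r=|x|>r_1$ the following series of vectors converges, and $$(u-H)(x)=\boldsymbol e^T\sum_{n=1}^{\infty}a_n\frac{e^{\mathrm i n\theta}}{r^n}\,\Upsilon_N^{(n)}\big(\mathbb M_N^{(n)}\big)^{-1}\boldsymbol e .$$ -/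

import Mathlib

open MeasureTheory Filter Topology
open scoped ContDiff

/-! The plane `ℝ²` is identified with `ℂ` (Euclidean norm, Lebesgue measure), so that the point with
polar coordinates `(r, θ)` is `x = r e^{iθ}`, with `r = ‖x‖` and `θ = Complex.arg x`.  Layers are
numbered `0, …, N` and interfaces `1, …, N`; `r k` is the radius of the `k`-th interface and `σ k` is
the conductivity of the `k`-th layer.  Values of the sequences outside these ranges are irrelevant. -/

namespace ConcentricDisks

/-- The `k`-th layer: `A₀ = {r > r₁}`, `A_k = {r_{k+1} < r ≤ r_k}` for `1 ≤ k < N`, and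
`A_N = {r ≤ r_N}`. -/
def layer (N : ℕ) (r : ℕ → ℝ) (k : ℕ) : Set ℂ :=
  {x | (1 ≤ k → ‖x‖ ≤ r k) ∧ (k < N → r (k + 1) < ‖x‖)}

/-- The piecewise constant conductivity of the whole plane, equal to `σ k` on the `k`-th layer. -/
noncomputable def conductivity (N : ℕ) (σ r : ℕ → ℝ) (x : ℂ) : ℝ :=
  ∑ k ∈ Finset.range (N + 1), (layer N r k).indicator (fun _ => σ k) x

/-- `u` belongs to `H¹_loc(ℝ²)` and its weak (distributional) gradient is `(g₁, g₂)`. -/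
structure HasWeakGradient (u g₁ g₂ : ℂ → ℂ) : Prop where
  memLp : ∀ K : Set ℂ, IsCompact K → MemLp u 2 (volume.restrict K)
  memLp_fst : ∀ K : Set ℂ, IsCompact K → MemLp g₁ 2 (volume.restrict K)
  memLp_snd : ∀ K : Set ℂ, IsCompact K → MemLp g₂ 2 (volume.restrict K)
  integral_fst : ∀ φ : ℂ → ℝ, ContDiff ℝ ∞ φ → HasCompactSupport φ →
    ∫ x, ((fderiv ℝ φ x 1 : ℝ) : ℂ) * u x = -∫ x, (φ x : ℂ) * g₁ x
  integral_snd : ∀ φ : ℂ → ℝ, ContDiff ℝ ∞ φ → HasCompactSupport φ →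
    ∫ x, ((fderiv ℝ φ x Complex.I : ℝ) : ℂ) * u x = -∫ x, (φ x : ℂ) * g₂ x

/-- `∇ · (γ ∇u) = 0` in `ℝ²`, in the weak sense, for `u ∈ H¹_loc(ℝ²)`. -/
def IsWeakSolution (γ : ℂ → ℝ) (u : ℂ → ℂ) : Prop :=
  ∃ g₁ g₂ : ℂ → ℂ, HasWeakGradient u g₁ g₂ ∧
    ∀ φ : ℂ → ℝ, ContDiff ℝ ∞ φ → HasCompactSupport φ →
      ∫ x, (γ x : ℂ) * (g₁ x * ((fderiv ℝ φ x 1 : ℝ) : ℂ)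
        + g₂ x * ((fderiv ℝ φ x Complex.I : ℝ) : ℂ)) = 0

/-- The conductivity problem: `∇ · (γ ∇u) = 0` in `ℝ²`, and `u - H = O(|x|⁻¹)` at infinity. -/
structure SolvesConductivityProblem (γ : ℂ → ℝ) (H u : ℂ → ℂ) : Prop where
  weak : IsWeakSolution γ u
  decay : (fun x => u x - H x) =O[Bornology.cobounded ℂ] fun x => ‖x‖⁻¹

/-- The outward unit normal of the circle centred at the origin that passes through `x ≠ 0`. -/
noncomputable def normal (x : ℂ) : ℂ := (‖x‖⁻¹ : ℝ) • x

/-- The transmission conditions `u|₊ = u|₋` and `σ_{k-1} ∂u/∂ν|₊ = σ_k ∂u/∂ν|₋` on the interfaces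
`{|x| = r_k}`, `1 ≤ k ≤ N`, where `w|_±(x) = lim_{h → 0⁺} w(x ± h ν)`. All the limits are required
to exist, and `u` to be differentiable where its normal derivative is taken. -/
def SatisfiesTransmission (N : ℕ) (σ r : ℕ → ℝ) (u : ℂ → ℂ) : Prop :=
  ∀ k : ℕ, 1 ≤ k → k ≤ N → ∀ x : ℂ, ‖x‖ = r k →
    (∃ c : ℂ, Tendsto (fun h : ℝ => u (x + h • normal x)) (𝓝[>] 0) (𝓝 c) ∧
      Tendsto (fun h : ℝ => u (x - h • normal x)) (𝓝[>] 0) (𝓝 c)) ∧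
    (∀ᶠ h : ℝ in 𝓝[>] 0, DifferentiableAt ℝ u (x + h • normal x) ∧
      DifferentiableAt ℝ u (x - h • normal x)) ∧
    ∃ p m : ℂ,
      Tendsto (fun h : ℝ => fderiv ℝ u (x + h • normal x) (normal x)) (𝓝[>] 0) (𝓝 p) ∧
      Tendsto (fun h : ℝ => fderiv ℝ u (x - h • normal x) (normal x)) (𝓝[>] 0) (𝓝 m) ∧
      (σ (k - 1) : ℂ) * p = (σ k : ℂ) * m

/-- The contrast `λ_k = (σ_k + σ_{k-1}) / (2 (σ_k - σ_{k-1}))`, for `k ≥ 1`. -/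
noncomputable def contrast (σ : ℕ → ℝ) (k : ℕ) : ℝ :=
  (σ k + σ (k - 1)) / (2 * (σ k - σ (k - 1)))

/-- The generalized polarization matrix of order `n`. The index `i : Fin N` stands for row or
column `i + 1`. -/
noncomputable def gpm (N : ℕ) (σ r : ℕ → ℝ) (n : ℕ) : Matrix (Fin N) (Fin N) ℝ :=
  Matrix.of fun i j =>
    if i = j then -2 * contrast σ (i + 1)
    else if i < j then (r (j + 1) / r (i + 1)) ^ (2 * n)
    else -1

/-- The diagonal matrix `diag(r₁^{2n}, …, r_N^{2n})`. -/
noncomputable def upsilon (N : ℕ) (r : ℕ → ℝ) (n : ℕ) : Matrix (Fin N) (Fin N) ℝ :=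
  Matrix.diagonal fun k => r (k + 1) ^ (2 * n)

/-- The vector `a_n (e^{inθ} / r^n) Υ_N^{(n)} (𝕄_N^{(n)})⁻¹ e` at the point `x = r e^{iθ}`, where
`e = (1, …, 1)ᵀ`. -/
noncomputable def scatteredTerm (N : ℕ) (σ r : ℕ → ℝ) (a : ℕ+ → ℂ) (x : ℂ) (n : ℕ+) :
    Fin N → ℂ :=
  (a n * (Complex.exp ((n : ℂ) * (Complex.arg x : ℂ) * Complex.I) / (‖x‖ : ℂ) ^ (n : ℕ))) •
    (((upsilon N r n * (gpm N σ r n)⁻¹).map Complex.ofReal).mulVec 1)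

end ConcentricDisks

/-! Existence is an explicit construction by reflection. Let `fold ρ` be the identity in the disk of
radius ρ and z ↦ ρ²/z̄ outside. For W entire with W(0) = 0, W ∘ fold ρ is continuous, holomorphic
inside, antiholomorphic outside and O(1/|z|); it sends zⁿ to ρ²ⁿ e^{inθ}/rⁿ outside. So u = H + ∑
W_j ∘ fold r_j is automatically continuous, piecewise harmonic and has the right decay. What remains
is the flux condition on each circle, and on the degree n coefficients of the W_j this is the linear
system with matrix 𝕄⁽ⁿ⁾ and right side a_n e. Hence W_j has coefficients a_n (𝕄⁽ⁿ⁾⁻¹ e)_j, and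
reading u − H outside r₁ gives the formula.

Two facts on the matrices are needed. 𝕄⁽ⁿ⁾ is invertible because a kernel vector is a radial mode
with no source, and such a mode vanishes by a discrete energy argument (`radial_mode_eq_zero`). The
vectors 𝕄⁽ⁿ⁾⁻¹ e are bounded in n because 𝕄⁽ⁿ⁾ tends to an invertible triangular matrix
(`exists_bound_gpm_inv`), so the W_j are entire.

The weak equation is checked with a stream function v: the flux γ∇u is the gradient of v rotated by
a right angle, v is continuous exactly because of the flux condition, and a rotated gradient is
weakly divergence free (`IsPiecewiseSmooth.isWeakSolution`).

Uniqueness: the difference w of two solutions is O(1/|x|). Caccioppoli's inequality with a cutoff at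
scale R bounds the energy in any fixed ball by a multiple of R⁻², so ∇w = 0; then w is constant,
hence zero by decay. -/

namespace ConcentricDisks

/-! ### Invertibility of the polarization matrices and bounds on their inverses. -/

/-- A radial mode `α r^n + β r^{-n}` of the transmission problem, regular at the origin and without
growing part at infinity, vanishes. Here `q k` stands for `r_k^{2n}`. -/
theorem radial_mode_eq_zero {N : ℕ} {s q α β : ℕ → ℝ} (hs : ∀ k ≤ N, 0 < s k)
    (hq : ∀ k < N, 0 < q k) (hanti : ∀ k, k + 1 < N → q (k + 1) < q k)
    (hcont : ∀ k < N, α k * q k + β k = α (k + 1) * q k + β (k + 1))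
    (hflux : ∀ k < N, s k * (α k * q k - β k) = s (k + 1) * (α (k + 1) * q k - β (k + 1)))
    (hα : α 0 = 0) (hβ : β N = 0) : ∀ k ≤ N, α k = 0 ∧ β k = 0 := by
  -- The inequality says that value times flux of the mode is nonnegative, as for the energy in a
  -- disk. It holds in the core, where β = 0, and crosses each interface because value and flux are
  -- continuous there. The free t lets it be used at the outer radius of the layer.
  have key : ∀ d k, k + d = N → ∀ t, (k < N → q k ≤ t) → β k ^ 2 ≤ (α k * t) ^ 2 := by
    intro d
    induction d with
    | zero =>
      intro k hk t _
      obtain rfl : k = N := by omega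
      rw [hβ, zero_pow two_ne_zero]; positivity
    | succ d ih =>
      intro k hk t ht
      have hkN : k < N := by omega
      have h1 := ih (k + 1) (by omega) (q k) (fun h => (hanti k h).le)
      have h2 := hcont k hkN
      have h3 := hflux k hkN
      have h4 : 0 ≤ s (k + 1) * (α (k + 1) * q k - β (k + 1)) *
          (α (k + 1) * q k + β (k + 1)) := by
        have := hs (k + 1) (by omega)
        have h5 : 0 ≤ (α (k + 1) * q k) ^ 2 - β (k + 1) ^ 2 := by linarith
        calc 0 ≤ s (k + 1) * ((α (k + 1) * q k) ^ 2 - β (k + 1) ^ 2) := by positivity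
          _ = _ := by ring
      rw [← h2, ← h3] at h4
      have h5 : 0 ≤ s k * ((α k * q k) ^ 2 - β k ^ 2) := by linarith
      have h6 := nonneg_of_mul_nonneg_right h5 (hs k hkN.le)
      have h7 : (α k * q k) ^ 2 ≤ (α k * t) ^ 2 := by
        rw [mul_pow, mul_pow]
        have := hq k hkN
        have := ht hkN
        gcongr
      linarith
  intro k
  induction k with
  | zero =>
    intro _
    -- In the unbounded layer α = 0, so the inequality leaves β = 0; continuity and flux then carry
    -- the zero inward.
    have := key N 0 (by omega) (q 0) (fun _ => le_rfl)
    rw [hα] at this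
    exact ⟨hα, by nlinarith⟩
  | succ k ih =>
    intro hk
    obtain ⟨h1, h2⟩ := ih (by omega)
    have h3 := hcont k (by omega)
    have h4 := hflux k (by omega)
    have hs' := hs (k + 1) hk
    have hq' := hq k (by omega)
    rw [h1, h2] at h3 h4
    have h5 : α (k + 1) * q k - β (k + 1) = 0 := by
      have : s (k + 1) * (α (k + 1) * q k - β (k + 1)) = 0 := by linarith
      exact (mul_eq_zero.1 this).resolve_left hs'.ne'
    have h6 : α (k + 1) * q k = 0 := by linarith
    exact ⟨(mul_eq_zero.1 h6).resolve_right hq'.ne', by linarith⟩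

section Matrix

variable {N : ℕ} {σ r : ℕ → ℝ}

theorem two_mul_contrast_mul {k : ℕ} (h : σ k ≠ σ (k - 1)) :
    2 * contrast σ k * (σ k - σ (k - 1)) = σ k + σ (k - 1) := by
  have := sub_ne_zero.2 h
  rw [contrast]
  field_simp

theorem sum_ite_lt_succ {E : Type*} [AddCommGroup E] (f g : Fin N → E) (i : Fin N) :
    ∑ j : Fin N, (if (j : ℕ) < i + 1 then f j else g j) =
      ∑ j : Fin N, (if (j : ℕ) < i then f j else g j) + (f i - g i) := by
  have h0 : ∑ j : Fin N, (if j = i then f j - g j else 0) = f i - g i := by simp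
  rw [← h0, ← Finset.sum_add_distrib]
  refine Finset.sum_congr rfl fun j _ => ?_
  rcases lt_trichotomy j i with h | h | h
  · have : (j : ℕ) < i := h
    simp [this, h.ne, Nat.lt_succ_of_lt this]
  · subst h; simp
  · have h1 : ¬ (j : ℕ) < i + 1 := by have : (i : ℕ) < j := h; omega
    have h2 : ¬ (j : ℕ) < i := by omega
    rw [if_neg h1, if_neg h2, if_neg h.ne']; simp

/-- A row of the polarization matrix, applied to a vector, in terms of the flux balance. -/
theorem sum_row_eq {E : Type*} [AddCommGroup E] (A B : Fin N → E) (i : Fin N) (l : E) :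
    ∑ j : Fin N, (if i = j then l else if i < j then B j else -A j) =
      l - (∑ j : Fin N, (if (j : ℕ) < i then A j else -B j)) - B i := by
  have : ∀ j : Fin N, (if i = j then l else if i < j then B j else -A j) =
      (if i = j then l - B i else 0) - (if (j : ℕ) < i then A j else -B j) := by
    intro j
    rcases lt_trichotomy j i with h | h | h
    · have h' : (j : ℕ) < i := h
      rw [if_neg h.ne', if_neg h.asymm, if_neg h.ne', if_pos h', zero_sub]
    · subst h; simp
    · have h' : ¬ (j : ℕ) < i := by have : (i : ℕ) < j := h; omega
      rw [if_neg h.ne, if_pos h, if_neg h.ne, if_neg h', zero_sub, neg_neg]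
  rw [Finset.sum_congr rfl fun j _ => this j, Finset.sum_sub_distrib, Finset.sum_ite_eq]
  simp only [Finset.mem_univ, if_true]
  abel

/-- A kernel vector w encodes a mode without source: interface j adds w_j rⁿ inside its circle and
w_j r_j²ⁿ r⁻ⁿ outside. The rows of the matrix are the flux conditions, so the mode, and with it w,
is zero. -/
theorem isUnit_gpm (hσ : ∀ k ≤ N, 0 < σ k)
    (hσne : ∀ k, 1 ≤ k → k ≤ N → σ k ≠ σ (k - 1))
    (hr : ∀ k, 1 ≤ k → k ≤ N → 0 < r k)
    (hrlt : ∀ k, 1 ≤ k → k < N → r (k + 1) < r k) {n : ℕ} (hn : 1 ≤ n) :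
    IsUnit (gpm N σ r n) := by
  rw [← Matrix.mulVec_injective_iff_isUnit, ← Matrix.coe_mulVecLin, ← LinearMap.ker_eq_bot,
    LinearMap.ker_eq_bot']
  intro w hw
  set q : ℕ → ℝ := fun k => r (k + 1) ^ (2 * n) with hqdef
  -- In layer m, the circles with index j < m (zero based) enclose the point and feed the growing
  -- part; the others feed the decaying part.
  set α : ℕ → ℝ := fun m => ∑ j : Fin N, if (j : ℕ) < m then w j else 0 with hαdef
  set β : ℕ → ℝ := fun m => ∑ j : Fin N, if (j : ℕ) < m then 0 else w j * q j with hβdef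
  have hq : ∀ k < N, 0 < q k := fun k hk => pow_pos (hr _ (by omega) (by omega)) _
  have hαs : ∀ i : Fin N, α (i + 1) = α i + w i := fun i => by
    simp only [hαdef]; rw [sum_ite_lt_succ w (fun _ => 0) i]; simp
  have hβs : ∀ i : Fin N, β (i + 1) = β i - w i * q i := fun i => by
    simp only [hβdef]; rw [sum_ite_lt_succ (fun _ => 0) (fun j => w j * q j) i]; simp [sub_eq_add_neg]
  have hrow : ∀ i : Fin N, β i - w i * q i - q i * α i = 2 * contrast σ (i + 1) * w i * q i := by
    intro i
    have h1 : (gpm N σ r n).mulVec w i = 0 := by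
      have := congrFun hw i
      simpa using this
    have hqi := (hq i i.2).ne'
    have h2 : ∀ j : Fin N, q i * (gpm N σ r n i j * w j) = if i = j then
        -2 * contrast σ (i + 1) * w i * q i else if i < j then w j * q j else -(w j * q i) := by
      intro j
      simp only [gpm, Matrix.of_apply]
      split_ifs with h h'
      · subst h; ring
      · rw [div_pow]
        change q i * (q j / q i * w j) = _
        field_simp
      · ring
    have h3 : ∑ j, q i * (gpm N σ r n i j * w j) = 0 := by
      rw [← Finset.mul_sum]
      change q i * (gpm N σ r n).mulVec w i = 0
      rw [h1, mul_zero]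
    rw [Finset.sum_congr rfl fun j _ => h2 j, sum_row_eq (fun j => w j * q i)] at h3
    have h4 : ∑ j : Fin N, (if (j : ℕ) < i then w j * q i else -(w j * q j)) =
        q i * α i - β i := by
      simp only [hαdef, hβdef, Finset.mul_sum, ← Finset.sum_sub_distrib]
      refine Finset.sum_congr rfl fun j _ => ?_
      split_ifs <;> ring
    rw [h4] at h3
    linarith
  have hzero := radial_mode_eq_zero (α := α) (β := β) hσ hq
    (fun k hk => by
      have := hrlt (k + 1) (by omega) (by omega)
      exact pow_lt_pow_left₀ this (hr _ (by omega) (by omega)).le (by omega))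
    (fun k hk => by rw [hαs ⟨k, hk⟩, hβs ⟨k, hk⟩]; ring)
    (fun k hk => by
      have h1 := hrow ⟨k, hk⟩
      have h2 := two_mul_contrast_mul (hσne (k + 1) (by omega) (by omega))
      rw [hαs ⟨k, hk⟩, hβs ⟨k, hk⟩]
      simp only [Nat.add_sub_cancel] at h1 h2 ⊢
      -- Row k multiplied by the jump of σ is the flux condition, once the contrast is cleared of
      -- its denominator.
      linear_combination (σ (k + 1) - σ k) * h1 + w ⟨k, hk⟩ * q k * h2)
    (by simp [hαdef])
    (by
      simp only [hβdef]
      exact Finset.sum_eq_zero fun j _ => if_pos j.2)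
  funext i
  have h1 := (hzero i i.2.le).1
  have h2 := (hzero (i + 1) i.2).1
  rw [hαs, h1, zero_add] at h2
  exact h2

/-- The coefficients `(𝕄_N^{(n)})⁻¹ e` are bounded in `n`. -/
theorem exists_bound_gpm_inv (hσ : ∀ k ≤ N, 0 < σ k)
    (hσne : ∀ k, 1 ≤ k → k ≤ N → σ k ≠ σ (k - 1))
    (hr : ∀ k, 1 ≤ k → k ≤ N → 0 < r k)
    (hrlt : ∀ i j : Fin N, i < j → r (j + 1) < r (i + 1)) (j : Fin N) :
    ∃ C : ℝ, ∀ n, |((gpm N σ r n)⁻¹.mulVec 1) j| ≤ C := by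
  -- The limit as n → ∞: above the diagonal the ratios r_j/r_i are less than 1 and their powers die
  -- out. L is lower triangular with diagonal −2λ_i, nonzero since σ_i + σ_{i−1} > 0. Inversion is
  -- continuous at L, and a convergent sequence is bounded.
  set L : Matrix (Fin N) (Fin N) ℝ := Matrix.of fun i j =>
    if i = j then -2 * contrast σ (i + 1) else if i < j then 0 else -1 with hL
  have hlim : Tendsto (gpm N σ r) atTop (𝓝 L) := by
    refine tendsto_pi_nhds.2 fun i => tendsto_pi_nhds.2 fun j => ?_
    simp only [gpm, hL, Matrix.of_apply]
    split_ifs with h h'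
    · exact tendsto_const_nhds
    · have h1 := hr (i + 1) (by omega) (by omega)
      have h2 := hr (j + 1) (by omega) (by omega)
      have h3 : r (j + 1) / r (i + 1) < 1 := (div_lt_one h1).2 (hrlt i j h')
      exact (tendsto_pow_atTop_nhds_zero_of_lt_one (by positivity) h3).comp
        (tendsto_id.const_mul_atTop' (by norm_num : 0 < 2))
    · exact tendsto_const_nhds
  have hdet : L.det ≠ 0 := by
    rw [Matrix.det_of_isLowerTriangular]
    · refine Finset.prod_ne_zero_iff.2 fun i _ => ?_
      have h1 := two_mul_contrast_mul (hσne (i + 1) (by omega) (by omega))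
      have h2 := hσ (i + 1) (by omega)
      have h3 := hσ i (by omega)
      simp only [hL, Matrix.of_apply, if_true]
      intro h
      have h4 : contrast σ (i + 1) = 0 := by linarith
      rw [h4] at h1
      simp only [Nat.add_sub_cancel] at h1
      linarith
    · intro i j hij
      have hij' : i < j := hij
      simp [hL, hij'.ne, hij']
  have hinv : Tendsto (fun n => (gpm N σ r n)⁻¹.mulVec 1) atTop (𝓝 (L⁻¹.mulVec 1)) := by
    simp only [Matrix.inv_def, Ring.inverse_eq_inv']
    have h1 : Tendsto (fun n => (gpm N σ r n).det⁻¹) atTop (𝓝 L.det⁻¹) :=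
      ((continuous_id.matrix_det.tendsto L).comp hlim).inv₀ hdet
    have h2 : Tendsto (fun n => (gpm N σ r n).adjugate) atTop (𝓝 L.adjugate) :=
      (continuous_id.matrix_adjugate.tendsto L).comp hlim
    exact ((continuous_id.matrix_mulVec continuous_const).tendsto _).comp (h1.smul h2)
  obtain ⟨C, hC⟩ := (Metric.isBounded_range_of_tendsto _ (tendsto_pi_nhds.1 hinv j)).exists_norm_le
  exact ⟨C, fun n => hC _ ⟨n, rfl⟩⟩

end Matrix

/-! ### Integration by parts for functions smooth off finitely many circles. -/

/-- Along a line ‖p + x e‖² is a monic quadratic in x, so each radius is met at most twice. This is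
the exceptional set allowed in the fundamental theorem of calculus. -/
theorem countable_setOf_norm_add_smul_mem (S : Finset ℝ) (p : ℂ) {e : ℂ} (he : ‖e‖ = 1) :
    {x : ℝ | ‖p + x • e‖ ∈ S}.Countable := by
  have h : {x : ℝ | ‖p + x • e‖ ∈ S} ⊆ ⋃ s ∈ S,
      {-inner ℝ p e + √(s ^ 2 - ‖p‖ ^ 2 + inner ℝ p e ^ 2),
        -inner ℝ p e - √(s ^ 2 - ‖p‖ ^ 2 + inner ℝ p e ^ 2)} := by
    intro x hx
    simp only [Set.mem_iUnion]
    refine ⟨_, hx, ?_⟩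
    have h1 : ‖p + x • e‖ ^ 2 - ‖p‖ ^ 2 + inner ℝ p e ^ 2 = (x + inner ℝ p e) ^ 2 := by
      rw [norm_add_sq_real, inner_smul_right, norm_smul, he, mul_one, Real.norm_eq_abs, sq_abs]
      ring
    rw [h1, Real.sqrt_sq_eq_abs]
    rcases abs_choice (x + inner ℝ p e) with h | h <;> rw [h]
    · left; ring
    · right; simp
  exact (Set.Finite.countable (S.finite_toSet.biUnion fun s _ => by simp)).mono h

/-- The integral of a derivative along a line vanishes, for a compactly supported function that is
differentiable off finitely many circles centred at the origin. -/
theorem integral_fderiv_line_eq_zero {F : ℂ → ℂ} (hF : Continuous F) (hc : HasCompactSupport F)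
    (S : Finset ℝ) (hd : ∀ z, ‖z‖ ∉ S → DifferentiableAt ℝ F z) (p : ℂ) {e : ℂ} (he : ‖e‖ = 1)
    (hi : Integrable fun x : ℝ => fderiv ℝ F (p + x • e) e) :
    ∫ x : ℝ, fderiv ℝ F (p + x • e) e = 0 := by
  obtain ⟨R, hR⟩ := hc.isCompact.isBounded.exists_norm_le
  set T : ℝ := |R| + ‖p‖ + 1
  have hT : 0 < T := by positivity
  have hout : ∀ x : ℝ, T ≤ |x| → p + x • e ∉ tsupport F := by
    intro x hx hmem
    have h1 := hR _ hmem
    have h2 : ‖x • e‖ ≤ ‖p + x • e‖ + ‖p‖ := by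
      simpa using norm_sub_le (p + x • e) p
    rw [norm_smul, he, mul_one, Real.norm_eq_abs] at h2
    have := le_abs_self R
    linarith
  have hsupp : Function.support (fun x : ℝ => fderiv ℝ F (p + x • e) e) ⊆ Set.Ioc (-T) T := by
    intro x hx
    by_contra hx'
    refine hx ?_
    have : T ≤ |x| := by
      by_contra hlt
      have := abs_lt.1 (not_le.1 hlt)
      exact hx' ⟨this.1, this.2.le⟩
    have h0 : fderiv ℝ F (p + x • e) = 0 := by
      by_contra h
      exact hout x this (support_fderiv_subset ℝ h)
    simp only [h0, zero_apply]
  rw [← intervalIntegral.integral_eq_integral_of_support_subset hsupp]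
  have hderiv : ∀ x : ℝ, HasDerivAt (fun x : ℝ => p + x • e) e x := fun x => by
    simpa using ((hasDerivAt_id x).smul_const e).const_add p
  rw [integral_eq_of_hasDerivAt_off_countable (fun x : ℝ => F (p + x • e)) _
    (countable_setOf_norm_add_smul_mem S p he) (by fun_prop)
    (fun x hx => (hd _ hx.2).hasFDerivAt.comp_hasDerivAt x (hderiv x)) hi.intervalIntegrable]
  have h1 : F (p + T • e) = 0 := image_eq_zero_of_notMem_tsupport (hout _ (le_abs_self T))
  have h2 : F (p + (-T) • e) = 0 :=
    image_eq_zero_of_notMem_tsupport (hout _ (by rw [abs_neg]; exact le_abs_self T))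
  rw [h1, h2, sub_zero]

/-- By Fubini, since the integral vanishes on almost every horizontal line. -/
theorem integral_fderiv_one_eq_zero {F : ℂ → ℂ} (hF : Continuous F) (hc : HasCompactSupport F)
    (S : Finset ℝ) (hd : ∀ z, ‖z‖ ∉ S → DifferentiableAt ℝ F z)
    (hi : Integrable fun z => fderiv ℝ F z 1) : ∫ z, fderiv ℝ F z 1 = 0 := by
  have hmp := Complex.volume_preserving_equiv_real_prod.symm
  rw [← hmp.integral_comp', Measure.volume_eq_prod]
  have hi' := (hmp.integrable_comp_emb (MeasurableEquiv.measurableEmbedding _)).2 hi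
  rw [Measure.volume_eq_prod] at hi'
  refine (integral_prod_symm _ hi').trans ?_
  refine integral_eq_zero_of_ae ?_
  filter_upwards [hi'.prod_left_ae] with y hy
  have h : ∀ x : ℝ, Complex.measurableEquivRealProd.symm (x, y) =
      (y : ℂ) * Complex.I + x • (1 : ℂ) := fun x => by
    apply Complex.ext <;> simp
  simp only [Function.comp_def, h] at hy ⊢
  exact integral_fderiv_line_eq_zero hF hc S hd _ norm_one hy

theorem integral_fderiv_I_eq_zero {F : ℂ → ℂ} (hF : Continuous F) (hc : HasCompactSupport F)
    (S : Finset ℝ) (hd : ∀ z, ‖z‖ ∉ S → DifferentiableAt ℝ F z)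
    (hi : Integrable fun z => fderiv ℝ F z Complex.I) : ∫ z, fderiv ℝ F z Complex.I = 0 := by
  have hmp := Complex.volume_preserving_equiv_real_prod.symm
  rw [← hmp.integral_comp', Measure.volume_eq_prod]
  have hi' := (hmp.integrable_comp_emb (MeasurableEquiv.measurableEmbedding _)).2 hi
  rw [Measure.volume_eq_prod] at hi'
  refine (integral_prod _ hi').trans ?_
  refine integral_eq_zero_of_ae ?_
  filter_upwards [hi'.prod_right_ae] with x hx
  have h : ∀ y : ℝ, Complex.measurableEquivRealProd.symm (x, y) =
      (x : ℂ) + y • Complex.I := fun y => by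
    apply Complex.ext <;> simp
  simp only [Function.comp_def, h] at hx ⊢
  exact integral_fderiv_line_eq_zero hF hc S hd _ Complex.norm_I hx

theorem ae_norm_notMem (S : Finset ℝ) (hS : ∀ s ∈ S, s ≠ 0) : ∀ᵐ z : ℂ, ‖z‖ ∉ S := by
  have : ∀ s ∈ S, ∀ᵐ z : ℂ, ‖z‖ ≠ s := by
    intro s hs
    have := Measure.addHaar_sphere_of_ne_zero (volume : Measure ℂ) 0 (hS s hs)
    rw [ae_iff]
    convert this using 2
    ext z; simp
  have h2 := (ae_ball_iff S.countable_toSet).2 this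
  filter_upwards [h2] with z hz hmem
  exact hz _ hmem rfl

/-- Continuous functions that are differentiable off finitely many circles, with a locally bounded
derivative. -/
structure IsPiecewiseSmooth (S : Finset ℝ) (K : ℂ → ℝ) (f : ℂ → ℂ) : Prop where
  ne_zero : ∀ s ∈ S, s ≠ 0
  continuous : Continuous f
  differentiableAt : ∀ z, ‖z‖ ∉ S → DifferentiableAt ℝ f z
  continuous_bound : Continuous K
  norm_fderiv_le : ∀ z, ‖z‖ ∉ S → ‖fderiv ℝ f z‖ ≤ K z

namespace IsPiecewiseSmooth

variable {S : Finset ℝ} {K : ℂ → ℝ} {f : ℂ → ℂ}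

theorem memLp_fderiv (hf : IsPiecewiseSmooth S K f) {e : ℂ} (he : ‖e‖ = 1) {p : ENNReal}
    {A : Set ℂ} (hA : IsCompact A) :
    MemLp (fun z => fderiv ℝ f z e) p (volume.restrict A) := by
  obtain ⟨C, hC⟩ := hA.exists_bound_of_continuousOn hf.continuous_bound.continuousOn
  have : IsFiniteMeasure (volume.restrict A) := ⟨by simpa using hA.measure_lt_top⟩
  refine MemLp.of_bound (measurable_fderiv_apply_const ℝ f e).aestronglyMeasurable C ?_
  filter_upwards [ae_restrict_of_ae (ae_norm_notMem S hf.ne_zero),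
    ae_restrict_mem hA.measurableSet] with z hz hzA
  calc ‖fderiv ℝ f z e‖ ≤ ‖fderiv ℝ f z‖ * ‖e‖ := ContinuousLinearMap.le_opNorm _ _
    _ ≤ K z := by rw [he, mul_one]; exact hf.norm_fderiv_le z hz
    _ ≤ C := (le_abs_self _).trans (hC z hzA)

theorem memLp (hf : IsPiecewiseSmooth S K f) {p : ENNReal} {A : Set ℂ} (hA : IsCompact A) :
    MemLp f p (volume.restrict A) := by
  obtain ⟨C, hC⟩ := hA.exists_bound_of_continuousOn hf.continuous.continuousOn
  have : IsFiniteMeasure (volume.restrict A) := ⟨by simpa using hA.measure_lt_top⟩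
  refine MemLp.of_bound hf.continuous.aestronglyMeasurable C ?_
  filter_upwards [ae_restrict_mem hA.measurableSet] with z hz using hC z hz

end IsPiecewiseSmooth

/-- Continuous compactly supported functions can be integrated against locally integrable ones. -/
theorem integrable_mul_of_hasCompactSupport {ψ g : ℂ → ℂ} (hψ : Continuous ψ)
    (hc : HasCompactSupport ψ) (hg : IntegrableOn g (tsupport ψ)) :
    Integrable fun x => ψ x * g x := by
  have h : IntegrableOn (fun x => ψ x * g x) (tsupport ψ) :=
    hg.continuousOn_mul hψ.continuousOn hc.isCompact
  refine (integrableOn_iff_integrable_of_support_subset ?_).1 h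
  exact (Function.support_mul_subset_left _ _).trans (subset_tsupport _)

namespace IsPiecewiseSmooth

variable {S : Finset ℝ} {K : ℂ → ℝ} {f : ℂ → ℂ}

theorem integrable_mul (hf : IsPiecewiseSmooth S K f) {ψ : ℂ → ℂ} (hψ : Continuous ψ)
    (hc : HasCompactSupport ψ) : Integrable fun x => ψ x * f x :=
  integrable_mul_of_hasCompactSupport hψ hc
    (memLp_one_iff_integrable.1 (hf.memLp hc.isCompact))

theorem integrable_mul_fderiv (hf : IsPiecewiseSmooth S K f) {ψ : ℂ → ℂ} (hψ : Continuous ψ)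
    (hc : HasCompactSupport ψ) {e : ℂ} (he : ‖e‖ = 1) :
    Integrable fun x => ψ x * fderiv ℝ f x e :=
  integrable_mul_of_hasCompactSupport hψ hc
    (memLp_one_iff_integrable.1 (hf.memLp_fderiv he hc.isCompact))

/-- Integration by parts against a test function. -/
theorem integral_fderiv_mul (hf : IsPiecewiseSmooth S K f) {φ : ℂ → ℝ} (hφ : ContDiff ℝ 1 φ)
    (hc : HasCompactSupport φ) {e : ℂ} (he : e = 1 ∨ e = Complex.I) :
    ∫ x, ((fderiv ℝ φ x e : ℝ) : ℂ) * f x = -∫ x, (φ x : ℂ) * fderiv ℝ f x e := by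
  have hne : ‖e‖ = 1 := by rcases he with rfl | rfl <;> simp
  -- The product φ f has compact support, so its derivative integrates to zero; Leibniz' rule splits
  -- that integral into the two sides.
  set F : ℂ → ℂ := fun x => (φ x : ℂ) * f x with hFdef
  have hcφ : HasCompactSupport fun x => (φ x : ℂ) := hc.comp_left Complex.ofReal_zero
  have hcφ' : HasCompactSupport fun x => ((fderiv ℝ φ x e : ℝ) : ℂ) :=
    (hc.fderiv_apply ℝ e).comp_left Complex.ofReal_zero
  have hcont' : Continuous fun x => ((fderiv ℝ φ x e : ℝ) : ℂ) :=
    Complex.continuous_ofReal.comp ((hφ.continuous_fderiv one_ne_zero).clm_apply continuous_const)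
  have hcont : Continuous fun x => (φ x : ℂ) := Complex.continuous_ofReal.comp hφ.continuous
  have hdφ : ∀ x, HasFDerivAt (fun x => (φ x : ℂ)) (Complex.ofRealCLM.comp (fderiv ℝ φ x)) x :=
    fun x => Complex.ofRealCLM.hasFDerivAt.comp x (hφ.differentiable one_ne_zero x).hasFDerivAt
  have hdF : ∀ z, ‖z‖ ∉ S → HasFDerivAt F
      ((φ z : ℂ) • fderiv ℝ f z + f z • Complex.ofRealCLM.comp (fderiv ℝ φ z)) z :=
    fun z hz => (hdφ z).mul (hf.differentiableAt z hz).hasFDerivAt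
  have hFe : ∀ᵐ z, fderiv ℝ F z e =
      ((fderiv ℝ φ z e : ℝ) : ℂ) * f z + (φ z : ℂ) * fderiv ℝ f z e := by
    filter_upwards [ae_norm_notMem S hf.ne_zero] with z hz
    rw [(hdF z hz).fderiv]
    simp [mul_comm, add_comm]
  have hi1 := hf.integrable_mul hcont' hcφ'
  have hi2 := hf.integrable_mul_fderiv hcont hcφ hne
  have hFi : Integrable fun z => fderiv ℝ F z e := (hi1.add hi2).congr (hFe.mono fun z hz => hz.symm)
  have hF0 : ∫ z, fderiv ℝ F z e = 0 := by
    have hFc : Continuous F := hcont.mul hf.continuous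
    have hFs : HasCompactSupport F := hcφ.mul_right
    rcases he with rfl | rfl
    · exact integral_fderiv_one_eq_zero hFc hFs S (fun z hz => (hdF z hz).differentiableAt) hFi
    · exact integral_fderiv_I_eq_zero hFc hFs S (fun z hz => (hdF z hz).differentiableAt) hFi
  rw [integral_congr_ae hFe, integral_add hi1 hi2] at hF0
  exact eq_neg_of_add_eq_zero_left hF0

theorem hasWeakGradient (hf : IsPiecewiseSmooth S K f) :
    HasWeakGradient f (fun x => fderiv ℝ f x 1) (fun x => fderiv ℝ f x Complex.I) where
  memLp _ hA := hf.memLp hA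
  memLp_fst _ hA := hf.memLp_fderiv norm_one hA
  memLp_snd _ hA := hf.memLp_fderiv Complex.norm_I hA
  integral_fst _ hφ hc := hf.integral_fderiv_mul (hφ.of_le (by simp)) hc (.inl rfl)
  integral_snd _ hφ hc := hf.integral_fderiv_mul (hφ.of_le (by simp)) hc (.inr rfl)

/-- A function whose flux is the rotated gradient of a stream function is a weak solution. -/
theorem isWeakSolution {L : ℂ → ℝ} {v : ℂ → ℂ} {γ : ℂ → ℝ} (hf : IsPiecewiseSmooth S K f)
    (hv : IsPiecewiseSmooth S L v)
    (h1 : ∀ z, ‖z‖ ∉ S → (γ z : ℂ) * fderiv ℝ f z 1 = fderiv ℝ v z Complex.I)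
    (h2 : ∀ z, ‖z‖ ∉ S → (γ z : ℂ) * fderiv ℝ f z Complex.I = -fderiv ℝ v z 1) :
    IsWeakSolution γ f := by
  refine ⟨_, _, hf.hasWeakGradient, fun φ hφ hc => ?_⟩
  have hφ2 : ContDiff ℝ 2 φ := by exact_mod_cast contDiff_infty.1 hφ 2
  have hφ' : ContDiff ℝ 1 (fderiv ℝ φ) := hφ2.fderiv_right (by norm_num)
  set φ₁ : ℂ → ℝ := fun x => fderiv ℝ φ x 1
  set φ₂ : ℂ → ℝ := fun x => fderiv ℝ φ x Complex.I
  have hs : ∀ e, ContDiff ℝ 1 (fun x => fderiv ℝ φ x e) := fun e =>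
    hφ'.clm_apply contDiff_const
  have hcc : ∀ e, HasCompactSupport (fun x => fderiv ℝ φ x e) := fun e => hc.fderiv_apply ℝ e
  have hcc' : ∀ e, HasCompactSupport (fun x => ((fderiv ℝ φ x e : ℝ) : ℂ)) := fun e =>
    (hcc e).comp_left Complex.ofReal_zero
  have hcont : ∀ e, Continuous fun x => ((fderiv ℝ φ x e : ℝ) : ℂ) := fun e =>
    Complex.continuous_ofReal.comp (hs e).continuous
  -- With the flux written through v, integrating by parts leaves v against the difference of the
  -- two mixed second derivatives of φ.
  have hsymm : ∀ x, fderiv ℝ φ₁ x Complex.I = fderiv ℝ φ₂ x 1 := by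
    intro x
    have hd : DifferentiableAt ℝ (fderiv ℝ φ) x :=
      hφ'.differentiable one_ne_zero x
    have hsy : IsSymmSndFDerivAt ℝ φ x := by
      refine ContDiffAt.isSymmSndFDerivAt hφ2.contDiffAt ?_
      simp
    simp only [φ₁, φ₂]
    rw [fderiv_clm_apply hd (differentiableAt_const _), fderiv_clm_apply hd (differentiableAt_const _)]
    simpa using hsy Complex.I 1
  have hae : ∀ᵐ z, (γ z : ℂ) * (fderiv ℝ f z 1 * (φ₁ z : ℂ) + fderiv ℝ f z Complex.I * (φ₂ z : ℂ)) =
      (φ₁ z : ℂ) * fderiv ℝ v z Complex.I - (φ₂ z : ℂ) * fderiv ℝ v z 1 := by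
    filter_upwards [ae_norm_notMem S hf.ne_zero] with z hz
    linear_combination (φ₁ z : ℂ) * h1 z hz + (φ₂ z : ℂ) * h2 z hz
  rw [integral_congr_ae hae, integral_sub
    (hv.integrable_mul_fderiv (hcont 1) (hcc' 1) Complex.norm_I)
    (hv.integrable_mul_fderiv (hcont Complex.I) (hcc' Complex.I) norm_one)]
  have e1 := hv.integral_fderiv_mul (hs 1) (hcc 1) (.inr rfl)
  have e2 := hv.integral_fderiv_mul (hs Complex.I) (hcc Complex.I) (.inl rfl)
  have e3 : ∫ x, ((fderiv ℝ φ₁ x Complex.I : ℝ) : ℂ) * v x =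
      ∫ x, ((fderiv ℝ φ₂ x 1 : ℝ) : ℂ) * v x := by simp only [hsymm]
  linear_combination e1 - e2 - e3

end IsPiecewiseSmooth

/-! ### Mollification of locally square integrable functions. -/

/-- Locally square integrable real functions on the plane. -/
def LocL2 (f : ℂ → ℝ) : Prop :=
  ∀ K : Set ℂ, IsCompact K → MemLp f 2 (volume.restrict K)

namespace LocL2

variable {f g : ℂ → ℝ}

theorem integrableOn (hf : LocL2 f) {K : Set ℂ} (hK : IsCompact K) : IntegrableOn f K := by
  have : IsFiniteMeasure (volume.restrict K) := ⟨by simpa using hK.measure_lt_top⟩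
  exact (hf K hK).integrable one_le_two

theorem locallyIntegrable (hf : LocL2 f) : LocallyIntegrable f :=
  locallyIntegrable_iff.2 fun _ hK => hf.integrableOn hK

theorem aestronglyMeasurable (hf : LocL2 f) : AEStronglyMeasurable f :=
  hf.locallyIntegrable.aestronglyMeasurable

theorem of_continuous (hf : Continuous f) : LocL2 f := by
  intro K hK
  have : IsFiniteMeasure (volume.restrict K) := ⟨by simpa using hK.measure_lt_top⟩
  obtain ⟨C, hC⟩ := hK.exists_bound_of_continuousOn hf.continuousOn
  refine MemLp.of_bound hf.aestronglyMeasurable C ?_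
  filter_upwards [ae_restrict_mem hK.measurableSet] with z hz using hC z hz

theorem bdd_mul {b : ℂ → ℝ} {C : ℝ} (hb : Measurable b) (hC : ∀ x, |b x| ≤ C) (hf : LocL2 f) :
    LocL2 (fun x => b x * f x) := by
  intro K hK
  refine (hf K hK).of_le_mul (c := C)
    (hb.aestronglyMeasurable.mul (hf K hK).aestronglyMeasurable) (ae_of_all _ fun x => ?_)
  rw [norm_mul]
  exact mul_le_mul_of_nonneg_right (hC x) (norm_nonneg _)

theorem integrable_mul_mul (hf : LocL2 f) (hg : LocL2 g) {ψ : ℂ → ℝ} (hψ : Continuous ψ)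
    (hc : HasCompactSupport ψ) : Integrable fun x => ψ x * (f x * g x) := by
  have h : IntegrableOn (fun x => ψ x * (f x * g x)) (tsupport ψ) :=
    IntegrableOn.continuousOn_mul hψ.continuousOn
      ((hf _ hc.isCompact).integrable_mul (hg _ hc.isCompact)) hc.isCompact
  refine (integrableOn_iff_integrable_of_support_subset ?_).1 h
  exact (Function.support_mul_subset_left _ _).trans (subset_tsupport _)

theorem integrable_mul (hf : LocL2 f) {ψ : ℂ → ℝ} (hψ : Continuous ψ)
    (hc : HasCompactSupport ψ) : Integrable fun x => ψ x * f x := by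
  simpa using hf.integrable_mul_mul (of_continuous (f := fun _ => 1) continuous_const) hψ hc

end LocL2

/-- Convolution of real functions on the plane. -/
noncomputable def conv (η f : ℂ → ℝ) : ℂ → ℝ :=
  convolution η f (ContinuousLinearMap.lsmul ℝ ℝ) volume

theorem conv_apply (η f : ℂ → ℝ) (x : ℂ) : conv η f x = ∫ t, η t * f (x - t) := rfl

theorem conv_apply_swap (η f : ℂ → ℝ) (x : ℂ) : conv η f x = ∫ t, η (x - t) * f t := by
  rw [conv, convolution_eq_swap]; rfl

theorem contDiff_conv {η f : ℂ → ℝ} (hη : ContDiff ℝ ∞ η) (hc : HasCompactSupport η)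
    (hf : LocL2 f) : ContDiff ℝ ∞ (conv η f) :=
  hc.contDiff_convolution_left _ hη hf.locallyIntegrable

/-- The derivative of a mollified function is the mollified weak derivative. -/
theorem fderiv_conv {η f g : ℂ → ℝ} (hη : ContDiff ℝ ∞ η) (hc : HasCompactSupport η)
    (hf : LocL2 f) {e : ℂ}
    (hg : ∀ φ : ℂ → ℝ, ContDiff ℝ ∞ φ → HasCompactSupport φ →
      ∫ x, fderiv ℝ φ x e * f x = -∫ x, φ x * g x) (x : ℂ) :
    fderiv ℝ (conv η f) x e = conv η g x := by
  have hη1 : ContDiff ℝ 1 η := hη.of_le (by simp)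
  have h1 := (hc.hasFDerivAt_convolution_left (ContinuousLinearMap.lsmul ℝ ℝ) hη1
    hf.locallyIntegrable x).fderiv
  have h2 := (hc.fderiv ℝ).convolutionExists_left
    (ContinuousLinearMap.precompL ℂ (ContinuousLinearMap.lsmul ℝ ℝ (E := ℝ)))
    (hη1.continuous_fderiv one_ne_zero) hf.locallyIntegrable x
  have h3 : fderiv ℝ (conv η f) x e = conv (fun y => fderiv ℝ η y e) f x := by
    change fderiv ℝ (convolution η f (ContinuousLinearMap.lsmul ℝ ℝ) volume) x e = _
    rw [h1, convolution_def, ContinuousLinearMap.integral_apply h2]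
    rfl
  have hφ := hg (fun t => η (x - t)) (hη.comp (contDiff_const.sub contDiff_id))
    (hc.comp_homeomorph (Homeomorph.subLeft x))
  have h4 : ∀ t, fderiv ℝ (fun t => η (x - t)) t e = -fderiv ℝ η (x - t) e := by
    intro t
    have h5 : HasFDerivAt (fun t : ℂ => x - t) (-ContinuousLinearMap.id ℝ ℂ) t :=
      (hasFDerivAt_id t).const_sub x
    have h6 := ((hη1.differentiable one_ne_zero (x - t)).hasFDerivAt.comp t h5).fderiv
    change fderiv ℝ (η ∘ fun t => x - t) t e = _
    rw [h6]; simp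
  rw [h3, conv_apply_swap, conv_apply_swap]
  simp only [h4, neg_mul, integral_neg, neg_inj] at hφ
  exact hφ

/-- The correlation of two square integrable functions is continuous. -/
theorem continuous_correlation {h f : ℂ → ℝ} (hh : MemLp h 2) (hf : MemLp f 2) :
    Continuous fun t : ℂ => ∫ x, h x * f (x + t) := by
  have hmp : ∀ t : ℂ, MeasurePreserving (ContinuousMap.id ℂ + ContinuousMap.const ℂ t) :=
    fun t => measurePreserving_add_right volume t
  have hcont : Continuous fun t : ℂ => (ContinuousMap.id ℂ + ContinuousMap.const ℂ t : C(ℂ, ℂ)) :=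
    continuous_const.add ContinuousMap.continuous_const'
  -- Translations act continuously on L², and the correlation is the inner product of h with a
  -- translate of f.
  have h1 := (continuous_const (y := hf.toLp f)).compMeasurePreservingLp hcont hmp (by simp)
  have h2 := (continuous_const (y := hh.toLp h)).inner (𝕜 := ℝ) h1
  refine h2.congr fun t => ?_
  rw [L2.inner_def]
  refine integral_congr_ae ?_
  filter_upwards [hh.coeFn_toLp, Lp.coeFn_compMeasurePreserving (hf.toLp f) (hmp t),
    (hmp t).quasiMeasurePreserving.ae_eq_comp hf.coeFn_toLp] with x hx1 hx2 hx3
  rw [hx1, hx2, hx3]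
  simp [mul_comm]

/-- By Fubini the pairing of h with η ∗ f is an average, with weight η, of the correlation of h and
f near the origin. The correlation is continuous, so the averages tend to its value at 0. -/
theorem tendsto_integral_mul_conv_of_memLp {h f : ℂ → ℝ} (hh : MemLp h 2) (hh1 : Integrable h)
    (hf : MemLp f 2) (hf1 : Integrable f) {η : ℕ → ContDiffBump (0 : ℂ)}
    (hη : Tendsto (fun n => (η n).rOut) atTop (𝓝 0)) :
    Tendsto (fun n => ∫ x, h x * conv ((η n).normed volume) f x) atTop (𝓝 (∫ x, h x * f x)) := by
  have hc : Continuous fun t : ℂ => ∫ x, h x * f (x + t) := continuous_correlation hh hf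
  have := ContDiffBump.convolution_tendsto_right_of_continuous (μ := volume) hη hc 0
  simp only [add_zero] at this
  refine this.congr fun n => ?_
  obtain ⟨C, hC⟩ := (η n).hasCompactSupport_normed (μ := volume).exists_bound_of_continuous
    (η n).continuous_normed
  have hint : Integrable (fun p : ℂ × ℂ => (η n).normed volume p.1 * (h p.2 * f (p.2 - p.1)))
      (volume.prod volume) := by
    have := hh1.convolution_integrand (ContinuousLinearMap.lsmul ℝ ℝ) hf1.comp_neg
    refine Integrable.bdd_mul (c := C) ?_ ?_ (ae_of_all _ fun p => hC _)
    · refine this.congr (ae_of_all _ fun p => ?_)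
      simp
    · exact ((η n).continuous_normed.comp continuous_fst).aestronglyMeasurable
  change ∫ t, (η n).normed volume t • (∫ x, h x * f (x + (0 - t))) = _
  simp only [smul_eq_mul, conv_apply, ← integral_const_mul, zero_sub, ← sub_eq_add_neg]
  rw [integral_integral_swap hint]
  refine integral_congr_ae (ae_of_all _ fun x => integral_congr_ae (ae_of_all _ fun t => ?_))
  simp only
  ring

/-- Mollifications converge weakly, tested against square integrable functions of the form `ψ h`
with `ψ` compactly supported. -/
theorem tendsto_integral_mul_conv {h f ψ : ℂ → ℝ} (hh : LocL2 h) (hf : LocL2 f)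
    (hψ : Continuous ψ) (hc : HasCompactSupport ψ) {η : ℕ → ContDiffBump (0 : ℂ)}
    (hη : Tendsto (fun n => (η n).rOut) atTop (𝓝 0)) :
    Tendsto (fun n => ∫ x, ψ x * (h x * conv ((η n).normed volume) f x)) atTop
      (𝓝 (∫ x, ψ x * (h x * f x))) := by
  obtain ⟨R, hR⟩ := hc.isCompact.isBounded.exists_norm_le
  -- Once the mollifier has radius less than 1, only the values of f within distance 1 of the
  -- support of ψ matter, so f may be cut off to a global L² function.
  set B : Set ℂ := Metric.closedBall 0 (R + 1)
  have hB : IsCompact B := isCompact_closedBall _ _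
  set f' : ℂ → ℝ := B.indicator f
  have hf2 : MemLp f' 2 := (memLp_indicator_iff_restrict hB.measurableSet).2 (hf B hB)
  have hf1 : Integrable f' := (integrable_indicator_iff hB.measurableSet).2 (hf.integrableOn hB)
  have hh1 : Integrable fun x => ψ x * h x := hh.integrable_mul hψ hc
  have hh2 : MemLp (fun x => ψ x * h x) 2 := by
    obtain ⟨C, hC⟩ := hc.exists_bound_of_continuous hψ
    have h1 := (hh _ hc.isCompact).of_le_mul (c := C) (f := fun x => ψ x * h x)
      hh1.aestronglyMeasurable.restrict (ae_of_all _ fun x => by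
        rw [norm_mul]; exact mul_le_mul_of_nonneg_right (hC x) (norm_nonneg _))
    have h2 := (memLp_indicator_iff_restrict (isClosed_tsupport ψ).measurableSet).2 h1
    rwa [Set.indicator_eq_self.2] at h2
    exact (Function.support_mul_subset_left _ _).trans (subset_tsupport _)
  have hzero : ∀ x, ‖x‖ ≤ R ∨ ψ x = 0 := fun x => by
    by_cases hx : x ∈ tsupport ψ
    · exact .inl (hR x hx)
    · exact .inr (image_eq_zero_of_notMem_tsupport hx)
  have hlim : ∫ x, ψ x * (h x * f x) = ∫ x, ψ x * h x * f' x := by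
    refine integral_congr_ae (ae_of_all _ fun x => ?_)
    rcases hzero x with hx | hx
    · have : x ∈ B := by simp [B]; linarith
      simp [f', this, mul_assoc]
    · simp [hx]
  rw [hlim]
  refine (tendsto_integral_mul_conv_of_memLp hh2 hh1 hf2 hf1 hη).congr' ?_
  filter_upwards [hη.eventually (gt_mem_nhds one_pos)] with n hn
  refine integral_congr_ae (ae_of_all _ fun x => ?_)
  simp only
  rcases hzero x with hx | hx
  · rw [mul_assoc, conv_apply, conv_apply]
    congr 2
    refine integral_congr_ae (ae_of_all _ fun t => ?_)
    simp only
    by_cases ht : t ∈ Metric.ball (0 : ℂ) (η n).rOut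
    · have : x - t ∈ B := by
        simp only [B, mem_closedBall_zero_iff, mem_ball_zero_iff] at ht ⊢
        linarith [norm_sub_le x t]
      simp [f', this]
    · have : (η n).normed volume t = 0 := by
        rw [← Function.notMem_support, (η n).support_normed_eq]; exact ht
      simp [this]
  · simp [hx]

/-! ### Energy estimates and uniqueness. -/

/-- `w` has the weak gradient `(g₁, g₂)` in `H¹_loc`, and `∇ · (γ ∇w) = 0` weakly. -/
structure IsRealWeakSolution (γ w g₁ g₂ : ℂ → ℝ) : Prop where
  loc : LocL2 w
  loc_fst : LocL2 g₁
  loc_snd : LocL2 g₂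
  integral_fst : ∀ φ : ℂ → ℝ, ContDiff ℝ ∞ φ → HasCompactSupport φ →
    ∫ x, fderiv ℝ φ x 1 * w x = -∫ x, φ x * g₁ x
  integral_snd : ∀ φ : ℂ → ℝ, ContDiff ℝ ∞ φ → HasCompactSupport φ →
    ∫ x, fderiv ℝ φ x Complex.I * w x = -∫ x, φ x * g₂ x
  weak : ∀ φ : ℂ → ℝ, ContDiff ℝ ∞ φ → HasCompactSupport φ →
    ∫ x, γ x * (g₁ x * fderiv ℝ φ x 1 + g₂ x * fderiv ℝ φ x Complex.I) = 0

theorem continuous_fderiv_apply {φ : ℂ → ℝ} (hφ : ContDiff ℝ ∞ φ) (e : ℂ) :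
    Continuous fun x => fderiv ℝ φ x e :=
  (hφ.continuous_fderiv (by simp)).clm_apply continuous_const

namespace IsRealWeakSolution

variable {γ w g₁ g₂ : ℂ → ℝ}

/-- The weak equation tested with `ψ w`. -/
theorem energy_identity (h : IsRealWeakSolution γ w g₁ g₂) (hγ : Measurable γ) {C : ℝ}
    (hC : ∀ x, |γ x| ≤ C) {ψ : ℂ → ℝ} (hψ : ContDiff ℝ ∞ ψ) (hc : HasCompactSupport ψ) :
    (∫ x, fderiv ℝ ψ x 1 * ((γ x * g₁ x) * w x)) + (∫ x, ψ x * ((γ x * g₁ x) * g₁ x)) +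
      ((∫ x, fderiv ℝ ψ x Complex.I * ((γ x * g₂ x) * w x)) +
        ∫ x, ψ x * ((γ x * g₂ x) * g₂ x)) = 0 := by
  have hk₁ : LocL2 fun x => γ x * g₁ x := h.loc_fst.bdd_mul hγ hC
  have hk₂ : LocL2 fun x => γ x * g₂ x := h.loc_snd.bdd_mul hγ hC
  let η : ℕ → ContDiffBump (0 : ℂ) := fun n =>
    ⟨1 / (2 * (n + 1)), 1 / (n + 1), by positivity, by
      apply one_div_lt_one_div_of_lt <;> linarith [(Nat.cast_nonneg n : (0 : ℝ) ≤ n)]⟩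
  have hη : Tendsto (fun n => (η n).rOut) atTop (𝓝 0) := tendsto_one_div_add_atTop_nhds_zero_nat
  have hd := fun e => continuous_fderiv_apply hψ e
  have hdc : ∀ e, HasCompactSupport fun x => fderiv ℝ ψ x e := fun e => hc.fderiv_apply ℝ e
  -- Each term of the tested equation is linear in the mollified function, so weak convergence of
  -- mollifications suffices for the limit.
  have t1 := tendsto_integral_mul_conv hk₁ h.loc (hd 1) (hdc 1) hη
  have t2 := tendsto_integral_mul_conv hk₁ h.loc_fst hψ.continuous hc hη
  have t3 := tendsto_integral_mul_conv hk₂ h.loc (hd Complex.I) (hdc Complex.I) hη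
  have t4 := tendsto_integral_mul_conv hk₂ h.loc_snd hψ.continuous hc hη
  refine tendsto_nhds_unique ((t1.add t2).add (t3.add t4)) ?_
  refine tendsto_const_nhds.congr fun n => ?_
  set ζ : ℂ → ℝ := (η n).normed volume
  have hζ : ContDiff ℝ ∞ ζ := (η n).contDiff_normed
  have hζc : HasCompactSupport ζ := (η n).hasCompactSupport_normed
  have s0 := contDiff_conv hζ hζc h.loc
  have s1 := contDiff_conv hζ hζc h.loc_fst
  have s2 := contDiff_conv hζ hζc h.loc_snd
  have e0 := LocL2.of_continuous s0.continuous
  have hweak := h.weak (fun x => ψ x * conv ζ w x) (hψ.mul s0) hc.mul_right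
  have hfd : ∀ x e, fderiv ℝ (fun x => ψ x * conv ζ w x) x e =
      fderiv ℝ ψ x e * conv ζ w x + ψ x * fderiv ℝ (conv ζ w) x e := fun x e => by
    rw [fderiv_fun_mul (hψ.differentiable (by simp) x) (s0.differentiable (by simp) x)]
    change ψ x * fderiv ℝ (conv ζ w) x e + conv ζ w x * fderiv ℝ ψ x e = _
    ring
  have i1 := hk₁.integrable_mul_mul e0 (hd 1) (hdc 1)
  have i2 := hk₁.integrable_mul_mul (.of_continuous s1.continuous) hψ.continuous hc
  have i3 := hk₂.integrable_mul_mul e0 (hd Complex.I) (hdc Complex.I)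
  have i4 := hk₂.integrable_mul_mul (.of_continuous s2.continuous) hψ.continuous hc
  rw [← integral_add' i1 i2, ← integral_add' i3 i4, ← integral_add' (i1.add i2) (i3.add i4),
    ← hweak]
  refine integral_congr_ae (ae_of_all _ fun x => ?_)
  simp only [Pi.add_apply, hfd, fderiv_conv hζ hζc h.loc h.integral_fst,
    fderiv_conv hζ hζc h.loc h.integral_snd]
  ring

/-- Caccioppoli's inequality. -/
theorem caccioppoli (h : IsRealWeakSolution γ w g₁ g₂) (hγ : Measurable γ) {C : ℝ}
    (hC : ∀ x, γ x ≤ C) (hγ0 : ∀ x, 0 ≤ γ x) {χ : ℂ → ℝ} (hχ : ContDiff ℝ ∞ χ)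
    (hc : HasCompactSupport χ) :
    ∫ x, χ x ^ 2 * (γ x * (g₁ x ^ 2 + g₂ x ^ 2)) ≤
      ∫ x, 4 * (fderiv ℝ χ x 1 ^ 2 + fderiv ℝ χ x Complex.I ^ 2) * (γ x * w x ^ 2) := by
  have hC' : ∀ x, |γ x| ≤ C := fun x => by rw [abs_of_nonneg (hγ0 x)]; exact hC x
  have hk₁ : LocL2 fun x => γ x * g₁ x := h.loc_fst.bdd_mul hγ hC'
  have hk₂ : LocL2 fun x => γ x * g₂ x := h.loc_snd.bdd_mul hγ hC'
  have hk : LocL2 fun x => γ x * w x := h.loc.bdd_mul hγ hC'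
  have hψ : ContDiff ℝ ∞ fun x => χ x ^ 2 := hχ.pow 2
  have hψc : HasCompactSupport fun x => χ x ^ 2 := hc.comp_left (g := fun t => t ^ 2) (by simp)
  have hd := fun e => continuous_fderiv_apply hψ e
  have hdc : ∀ e, HasCompactSupport fun x => fderiv ℝ (fun x => χ x ^ 2) x e :=
    fun e => hψc.fderiv_apply ℝ e
  have hdχ := fun e => continuous_fderiv_apply hχ e
  have hdχc : ∀ e, HasCompactSupport fun x => fderiv ℝ χ x e ^ 2 := fun e => (hc.fderiv_apply ℝ e).comp_left (g := fun t => t ^ 2) (by simp)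
  have hE := h.energy_identity hγ hC' hψ hψc
  have i1 := hk₁.integrable_mul_mul h.loc (hd 1) (hdc 1)
  have i2 := hk₁.integrable_mul_mul h.loc_fst hψ.continuous hψc
  have i3 := hk₂.integrable_mul_mul h.loc (hd Complex.I) (hdc Complex.I)
  have i4 := hk₂.integrable_mul_mul h.loc_snd hψ.continuous hψc
  have i5 : Integrable fun x => 4 * (fderiv ℝ χ x 1 ^ 2 + fderiv ℝ χ x Complex.I ^ 2) *
      (γ x * w x * w x) :=
    hk.integrable_mul_mul h.loc
      (continuous_const.mul (((hdχ 1).pow 2).add ((hdχ Complex.I).pow 2)))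
      (((hdχc 1).add (hdχc Complex.I)).mul_left)
  rw [← integral_add' i1 i2, ← integral_add' i3 i4, ← integral_add' (i1.add i2) (i3.add i4)] at hE
  have hfd : ∀ x e, fderiv ℝ (fun x => χ x ^ 2) x e = 2 * χ x * fderiv ℝ χ x e := fun x e => by
    rw [fderiv_fun_pow 2 (hχ.differentiable (by simp) x)]
    simp
  have i6 := i2.add i4
  -- This is γ(χ g + 2 w ∂χ)² ≥ 0 in each direction, expanded. The bracket with factor 2 is the
  -- integrand of the energy identity and integrates to zero.
  have hle : ∀ x, χ x ^ 2 * (γ x * (g₁ x ^ 2 + g₂ x ^ 2)) ≤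
      4 * (fderiv ℝ χ x 1 ^ 2 + fderiv ℝ χ x Complex.I ^ 2) * (γ x * w x * w x) +
      2 * ((fderiv ℝ (fun x => χ x ^ 2) x 1 * ((γ x * g₁ x) * w x) + χ x ^ 2 * ((γ x * g₁ x) * g₁ x))
      + (fderiv ℝ (fun x => χ x ^ 2) x Complex.I * ((γ x * g₂ x) * w x) +
        χ x ^ 2 * ((γ x * g₂ x) * g₂ x))) := by
    intro x
    rw [hfd, hfd]
    have h1 := mul_nonneg (hγ0 x) (sq_nonneg (χ x * g₁ x + 2 * fderiv ℝ χ x 1 * w x))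
    have h2 := mul_nonneg (hγ0 x) (sq_nonneg (χ x * g₂ x + 2 * fderiv ℝ χ x Complex.I * w x))
    linarith
  have i7 : Integrable fun x => χ x ^ 2 * (γ x * (g₁ x ^ 2 + g₂ x ^ 2)) :=
    i6.congr (ae_of_all _ fun x => by simp only [Pi.add_apply]; ring)
  refine (integral_mono i7 (i5.add (((i1.add i2).add (i3.add i4)).const_mul 2)) hle).trans ?_
  rw [integral_add' i5 (((i1.add i2).add (i3.add i4)).const_mul 2)]
  have hE' : ∫ x, 2 * ((((fun x => fderiv ℝ (fun x => χ x ^ 2) x 1 * ((γ x * g₁ x) * w x)) +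
      fun x => χ x ^ 2 * ((γ x * g₁ x) * g₁ x)) +
      ((fun x => fderiv ℝ (fun x => χ x ^ 2) x Complex.I * ((γ x * g₂ x) * w x)) +
        fun x => χ x ^ 2 * ((γ x * g₂ x) * g₂ x))) x) = 0 := by
    rw [integral_const_mul]
    exact mul_eq_zero_of_right _ hE
  rw [hE', add_zero]
  exact (integral_congr_ae (ae_of_all _ fun x => by ring)).le

/-- A weak solution that decays like `|x|⁻¹` has a vanishing weak gradient. -/
theorem gradient_eq_zero (h : IsRealWeakSolution γ w g₁ g₂) (hγ : Measurable γ) {c C : ℝ}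
    (hc : 0 < c) (hcγ : ∀ x, c ≤ γ x) (hC : ∀ x, γ x ≤ C)
    (hw : w =O[Bornology.cobounded ℂ] fun x => ‖x‖⁻¹) :
    (∀ᵐ x, g₁ x = 0) ∧ ∀ᵐ x, g₂ x = 0 := by
  have hγ0 : ∀ x, 0 ≤ γ x := fun x => hc.le.trans (hcγ x)
  have hC0 : 0 ≤ C := (hγ0 0).trans (hC 0)
  obtain ⟨A, hA⟩ := hw.bound
  obtain ⟨R₀, hR₀⟩ := hasBasis_cobounded_norm.eventually_iff.1 hA
  replace hR₀ := hR₀.2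
  let b : ContDiffBump (0 : ℂ) := ⟨1, 2, one_pos, one_lt_two⟩
  have hb : ContDiff ℝ ∞ b := b.contDiff
  obtain ⟨D, hD⟩ := (b.hasCompactSupport.fderiv ℝ).exists_bound_of_continuous
    (hb.continuous_fderiv (by simp))
  -- the energy in a ball is bounded by `R⁻²`
  have key : ∀ ρ : ℝ, ∀ R : ℝ, 0 < R → ρ ≤ R → R₀ ≤ R →
      ∫ x in Metric.closedBall (0 : ℂ) ρ, c * (g₁ x ^ 2 + g₂ x ^ 2) ≤
        (32 * D ^ 2 * C * A ^ 2 * Real.pi) * (R ^ 2)⁻¹ := by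
    intro ρ R hR hρR hR₀R
    set χ : ℂ → ℝ := fun x => b (R⁻¹ • x) with hχdef
    have hχ : ContDiff ℝ ∞ χ := hb.comp (contDiff_const_smul _)
    have hχc : HasCompactSupport χ :=
      b.hasCompactSupport.comp_smul (inv_ne_zero hR.ne')
    have hfd : ∀ x e, fderiv ℝ χ x e = R⁻¹ * fderiv ℝ b (R⁻¹ • x) e := fun x e => by
      have h1 : HasFDerivAt (fun x : ℂ => R⁻¹ • x) (R⁻¹ • ContinuousLinearMap.id ℝ ℂ) x :=
        (hasFDerivAt_id x).const_smul R⁻¹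
      have h2 := ((hb.differentiable (by simp) (R⁻¹ • x)).hasFDerivAt.comp x h1).fderiv
      change fderiv ℝ (b ∘ fun x => R⁻¹ • x) x e = _
      rw [h2]
      simp only [ContinuousLinearMap.comp_apply, smul_apply, map_smul,
        ContinuousLinearMap.id_apply, smul_eq_mul]
    have hcac := h.caccioppoli hγ hC hγ0 hχ hχc
    have hlow : ∫ x in Metric.closedBall (0 : ℂ) ρ, c * (g₁ x ^ 2 + g₂ x ^ 2) ≤
        ∫ x, χ x ^ 2 * (γ x * (g₁ x ^ 2 + g₂ x ^ 2)) := by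
      have hψc : HasCompactSupport fun x => χ x ^ 2 := hχc.comp_left (g := fun t => t ^ 2) (by simp)
      have hC' : ∀ x, |γ x| ≤ C := fun x => by rw [abs_of_nonneg (hγ0 x)]; exact hC x
      have i2 := (h.loc_fst.bdd_mul hγ hC').integrable_mul_mul h.loc_fst (hχ.pow 2).continuous hψc
      have i4 := (h.loc_snd.bdd_mul hγ hC').integrable_mul_mul h.loc_snd (hχ.pow 2).continuous hψc
      have i7 : Integrable fun x => χ x ^ 2 * (γ x * (g₁ x ^ 2 + g₂ x ^ 2)) :=
        (i2.add i4).congr (ae_of_all _ fun x => by simp only [Pi.add_apply]; ring)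
      have hnn : ∀ x, 0 ≤ χ x ^ 2 * (γ x * (g₁ x ^ 2 + g₂ x ^ 2)) := fun x => by
        have := hγ0 x; positivity
      refine le_trans ?_ (setIntegral_le_integral (s := Metric.closedBall (0 : ℂ) ρ) i7
        (ae_of_all _ hnn))
      refine integral_mono_of_nonneg (ae_of_all _ fun x => by positivity) i7.integrableOn ?_
      filter_upwards [ae_restrict_mem Metric.isClosed_closedBall.measurableSet] with x hx
      have hx1 : χ x = 1 := by
        refine b.one_of_mem_closedBall ?_
        rw [mem_closedBall_zero_iff] at hx ⊢
        rw [norm_smul, norm_inv, Real.norm_of_nonneg hR.le, inv_mul_le_iff₀ hR]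
        simp only [b]; linarith
      rw [hx1, one_pow, one_mul]
      exact mul_le_mul_of_nonneg_right (hcγ x) (by positivity)
    refine hlow.trans (hcac.trans ?_)
    -- ∇χ lives on R ≤ |x| ≤ 2R. There each ∂χ is at most D/R and |w| at most A/R, so the integrand
    -- is of order R⁻⁴ on a disk of area 4πR².
    have hup : ∀ x, 4 * (fderiv ℝ χ x 1 ^ 2 + fderiv ℝ χ x Complex.I ^ 2) * (γ x * w x ^ 2) ≤
        (Metric.closedBall (0 : ℂ) (2 * R)).indicator
          (fun _ => 8 * D ^ 2 * C * A ^ 2 * (R ^ 2)⁻¹ * (R ^ 2)⁻¹) x := by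
      intro x
      have hfd0 : fderiv ℝ b (R⁻¹ • x) = 0 → 4 * (fderiv ℝ χ x 1 ^ 2 +
          fderiv ℝ χ x Complex.I ^ 2) * (γ x * w x ^ 2) = 0 := fun h0 => by
        rw [hfd, hfd, h0]; simp
      have hnn : 0 ≤ (Metric.closedBall (0 : ℂ) (2 * R)).indicator
          (fun _ => 8 * D ^ 2 * C * A ^ 2 * (R ^ 2)⁻¹ * (R ^ 2)⁻¹) x :=
        Set.indicator_nonneg (fun _ _ => by positivity) _
      have hnorm : ‖R⁻¹ • x‖ = R⁻¹ * ‖x‖ := by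
        rw [norm_smul, norm_inv, Real.norm_of_nonneg hR.le]
      by_cases hlt : ‖x‖ < R
      · have h0 : fderiv ℝ b (R⁻¹ • x) = 0 := by
          have : (b : ℂ → ℝ) =ᶠ[𝓝 (R⁻¹ • x)] fun _ => 1 := by
            refine b.eventuallyEq_one_of_mem_ball ?_
            rw [mem_ball_zero_iff, hnorm, inv_mul_lt_iff₀ hR]
            simp only [b]; linarith
          rw [this.fderiv_eq]; simp
        rw [hfd0 h0]; exact hnn
      · by_cases hgt : ‖x‖ ≤ 2 * R
        · have hmem : x ∈ Metric.closedBall (0 : ℂ) (2 * R) := by simpa using hgt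
          rw [Set.indicator_of_mem hmem]
          have hR' := not_lt.1 hlt
          have hbd : ∀ e : ℂ, ‖e‖ = 1 → fderiv ℝ χ x e ^ 2 ≤ D ^ 2 * (R ^ 2)⁻¹ := by
            intro e he
            have h1 : |fderiv ℝ b (R⁻¹ • x) e| ≤ D := by
              have := (fderiv ℝ b (R⁻¹ • x)).le_opNorm e
              rw [he, mul_one, Real.norm_eq_abs] at this
              exact this.trans (hD _)
            rw [hfd, mul_pow, inv_pow, mul_comm]
            have := sq_le_sq' (abs_le.1 h1).1 (abs_le.1 h1).2
            gcongr
          have hwx : w x ^ 2 ≤ A ^ 2 * (R ^ 2)⁻¹ := by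
            have h1 : ‖w x‖ ≤ A * ‖‖x‖⁻¹‖ := hR₀ (show R₀ ≤ ‖x‖ by linarith)
            rw [norm_inv, norm_norm] at h1
            have hx0 : 0 < ‖x‖ := hR.trans_le hR'
            have h2 : ‖w x‖ ^ 2 ≤ (A * ‖x‖⁻¹) ^ 2 := by gcongr
            rw [Real.norm_eq_abs, sq_abs, mul_pow, inv_pow] at h2
            refine h2.trans ?_
            gcongr
          calc _ ≤ 4 * (D ^ 2 * (R ^ 2)⁻¹ + D ^ 2 * (R ^ 2)⁻¹) * (C * (A ^ 2 * (R ^ 2)⁻¹)) := by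
                have := hbd 1 norm_one
                have := hbd Complex.I Complex.norm_I
                have := hC x
                have := hγ0 x
                gcongr
            _ = _ := by ring
        · have h0 : fderiv ℝ b (R⁻¹ • x) = 0 := by
            by_contra hne
            have h1 : R⁻¹ • x ∈ tsupport (b : ℂ → ℝ) := support_fderiv_subset ℝ hne
            rw [b.tsupport_eq, mem_closedBall_zero_iff, hnorm, inv_mul_le_iff₀ hR] at h1
            simp only [b] at h1
            exact hgt (by linarith)
          rw [hfd0 h0]; exact hnn
    have hint : Integrable ((Metric.closedBall (0 : ℂ) (2 * R)).indicator
          (fun _ => 8 * D ^ 2 * C * A ^ 2 * (R ^ 2)⁻¹ * (R ^ 2)⁻¹)) := by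
      rw [integrable_indicator_iff Metric.isClosed_closedBall.measurableSet]
      exact integrableOn_const (by exact (isCompact_closedBall _ _).measure_lt_top.ne)
    refine (integral_mono_of_nonneg (ae_of_all _ fun x => ?_) hint (ae_of_all _ hup)).trans ?_
    · have := hγ0 x
      simp only [Pi.zero_apply]; positivity
    · rw [integral_indicator_const _ Metric.isClosed_closedBall.measurableSet, measureReal_def,
        Complex.volume_closedBall, ENNReal.toReal_mul, ENNReal.toReal_pow,
        ENNReal.toReal_ofReal (by positivity), smul_eq_mul]
      simp only [ENNReal.coe_toReal, NNReal.coe_real_pi]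
      apply le_of_eq
      field_simp
      ring
  have hzero : ∀ n : ℕ, ∀ᵐ x ∂volume.restrict (Metric.closedBall (0 : ℂ) n),
      g₁ x = 0 ∧ g₂ x = 0 := by
    intro n
    have hK : IsCompact (Metric.closedBall (0 : ℂ) n) := isCompact_closedBall _ _
    have hnn : ∀ x, 0 ≤ c * (g₁ x ^ 2 + g₂ x ^ 2) := fun x => by positivity
    have hi : Integrable (fun x => c * (g₁ x ^ 2 + g₂ x ^ 2))
        (volume.restrict (Metric.closedBall (0 : ℂ) n)) :=
      ((h.loc_fst _ hK).integrable_sq.add (h.loc_snd _ hK).integrable_sq).const_mul c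
    have hlim : Tendsto (fun R : ℝ => (32 * D ^ 2 * C * A ^ 2 * Real.pi) * (R ^ 2)⁻¹) atTop
        (𝓝 0) := by
      simpa using (tendsto_pow_atTop (α := ℝ) two_ne_zero).inv_tendsto_atTop.const_mul
        (32 * D ^ 2 * C * A ^ 2 * Real.pi)
    have hle : ∫ x in Metric.closedBall (0 : ℂ) n, c * (g₁ x ^ 2 + g₂ x ^ 2) ≤ 0 := by
      refine ge_of_tendsto hlim ?_
      filter_upwards [eventually_gt_atTop 0, eventually_ge_atTop (n : ℝ),
        eventually_ge_atTop R₀] with R h1 h2 h3 using key n R h1 h2 h3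
    have h0 := le_antisymm hle (integral_nonneg hnn)
    rw [integral_eq_zero_iff_of_nonneg hnn hi] at h0
    filter_upwards [h0] with x hx
    have hx' : g₁ x ^ 2 + g₂ x ^ 2 = 0 := (mul_eq_zero.1 hx).resolve_left hc.ne'
    constructor <;> nlinarith [sq_nonneg (g₁ x), sq_nonneg (g₂ x)]
  have hall : ∀ᵐ x, g₁ x = 0 ∧ g₂ x = 0 := by
    have := (ae_restrict_iUnion_iff (μ := volume) (fun n : ℕ => Metric.closedBall (0 : ℂ) n)
      (fun x => g₁ x = 0 ∧ g₂ x = 0)).2 hzero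
    rwa [Metric.iUnion_closedBall_nat, Measure.restrict_univ] at this
  exact ⟨hall.mono fun x hx => hx.1, hall.mono fun x hx => hx.2⟩

/-- Every mollification of w has zero gradient and tends to zero at infinity, so it vanishes. Its
value at 0, for the kernel φ(−x), is the integral of φ w. -/
theorem eq_zero_of_gradient_eq_zero (h : IsRealWeakSolution γ w g₁ g₂) (h1 : ∀ᵐ x, g₁ x = 0)
    (h2 : ∀ᵐ x, g₂ x = 0) (hw : Tendsto w (Bornology.cobounded ℂ) (𝓝 0)) : ∀ᵐ x, w x = 0 := by
  refine ae_eq_zero_of_integral_contDiff_smul_eq_zero h.loc.locallyIntegrable fun φ hφ hc => ?_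
  set ζ : ℂ → ℝ := fun x => φ (-x)
  have hζ : ContDiff ℝ ∞ ζ := hφ.comp contDiff_neg
  have hζc : HasCompactSupport ζ := hc.comp_homeomorph (Homeomorph.neg ℂ)
  have hconv0 : ∀ g : ℂ → ℝ, (∀ᵐ x, g x = 0) → ∀ x, conv ζ g x = 0 := fun g hg x => by
    rw [conv_apply_swap]
    exact integral_eq_zero_of_ae (hg.mono fun t ht => by simp [ht])
  have hs := contDiff_conv hζ hζc h.loc
  have hfd : ∀ x, fderiv ℝ (conv ζ w) x = 0 := by
    intro x
    have e1 := fderiv_conv hζ hζc h.loc h.integral_fst x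
    have e2 := fderiv_conv hζ hζc h.loc h.integral_snd x
    rw [hconv0 _ h1] at e1
    rw [hconv0 _ h2] at e2
    ext v
    have hv : v = v.re • (1 : ℂ) + v.im • Complex.I := by
      apply Complex.ext <;> simp
    rw [hv, map_add, map_smul, map_smul, e1, e2]
    simp
  have hconst := is_const_of_fderiv_eq_zero (hs.differentiable (by simp)) hfd
  have hlim : Tendsto (conv ζ w) (Bornology.cobounded ℂ) (𝓝 0) := by
    obtain ⟨R, hR⟩ := hζc.isCompact.isBounded.exists_norm_le
    have hint : Integrable ζ := hζ.continuous.integrable_of_hasCompactSupport hζc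
    rw [Metric.tendsto_nhds]
    intro ε hε
    set M : ℝ := ∫ x, ‖ζ x‖
    have hM : 0 ≤ M := integral_nonneg fun _ => norm_nonneg _
    have hδ : 0 < ε / (M + 1) := by positivity
    obtain ⟨T, -, hT⟩ := hasBasis_cobounded_norm.eventually_iff.1 (Metric.tendsto_nhds.1 hw _ hδ)
    refine hasBasis_cobounded_norm.eventually_iff.2 ⟨T + R, trivial, fun x hx => ?_⟩
    have hx' : T + R ≤ ‖x‖ := hx
    rw [dist_zero_right]
    calc ‖conv ζ w x‖ ≤ ∫ t, ‖ζ t‖ * (ε / (M + 1)) := by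
          rw [conv_apply]
          refine norm_integral_le_of_norm_le (hint.norm.mul_const _) (ae_of_all _ fun t => ?_)
          rw [norm_mul]
          by_cases ht : t ∈ tsupport ζ
          · have h3 : T ≤ ‖x - t‖ := by
              have := hR t ht
              have := norm_sub_norm_le x t
              linarith
            have h4 := hT h3
            rw [dist_zero_right] at h4
            gcongr
          · simp [image_eq_zero_of_notMem_tsupport ht]
      _ = M * (ε / (M + 1)) := integral_mul_const _ _
      _ < ε := by
          rw [← mul_div_assoc, div_lt_iff₀ (by positivity)]
          nlinarith
  have h0 : conv ζ w 0 = 0 := by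
    have : conv ζ w = fun _ => conv ζ w 0 := funext fun x => hconst x 0
    rw [this] at hlim
    exact tendsto_nhds_unique tendsto_const_nhds hlim
  rw [conv_apply_swap] at h0
  simpa [ζ] using h0

theorem ae_eq_zero (h : IsRealWeakSolution γ w g₁ g₂) (hγ : Measurable γ) {c C : ℝ}
    (hc : 0 < c) (hcγ : ∀ x, c ≤ γ x) (hC : ∀ x, γ x ≤ C)
    (hw : w =O[Bornology.cobounded ℂ] fun x => ‖x‖⁻¹) : ∀ᵐ x, w x = 0 := by
  obtain ⟨h1, h2⟩ := h.gradient_eq_zero hγ hc hcγ hC hw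
  exact h.eq_zero_of_gradient_eq_zero h1 h2
    (hw.trans_tendsto (tendsto_inv_atTop_zero.comp tendsto_norm_cobounded_atTop))

end IsRealWeakSolution

/-- The difference of two complex weak solutions, composed with a real linear functional, is a real
weak solution. -/
theorem exists_isRealWeakSolution {γ : ℂ → ℝ} {u v : ℂ → ℂ} (hu : IsWeakSolution γ u)
    (hv : IsWeakSolution γ v) (hγ : Measurable γ) {C : ℝ} (hC : ∀ x, |γ x| ≤ C) (l : ℂ →L[ℝ] ℝ) :
    ∃ g₁ g₂, IsRealWeakSolution γ (fun x => l (v x - u x)) g₁ g₂ := by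
  obtain ⟨p₁, p₂, hp, hpw⟩ := hu
  obtain ⟨q₁, q₂, hq, hqw⟩ := hv
  -- Conductivity and test functions are real, so a real linear functional passes through all the
  -- integral identities.
  have hl : ∀ (a : ℝ) (z : ℂ), l ((a : ℂ) * z) = a * l z := fun a z => by
    rw [← Complex.real_smul, map_smul, smul_eq_mul]
  have hlin : ∀ {f g : ℂ → ℂ}, (∀ K : Set ℂ, IsCompact K → MemLp f 2 (volume.restrict K)) →
      (∀ K : Set ℂ, IsCompact K → MemLp g 2 (volume.restrict K)) →
      LocL2 fun x => l (g x - f x) := fun hf hg K hK => l.comp_memLp' ((hg K hK).sub (hf K hK))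
  have hint : ∀ {f : ℂ → ℂ} {φ : ℂ → ℝ},
      (∀ K : Set ℂ, IsCompact K → MemLp f 2 (volume.restrict K)) → Continuous φ →
      HasCompactSupport φ → Integrable fun x => (φ x : ℂ) * f x := fun {f φ} hf hφ hc => by
    have hc' : HasCompactSupport fun x => (φ x : ℂ) := hc.comp_left Complex.ofReal_zero
    have : IsFiniteMeasure (volume.restrict (tsupport fun x => (φ x : ℂ))) :=
      ⟨by simpa using hc'.isCompact.measure_lt_top⟩
    exact integrable_mul_of_hasCompactSupport (Complex.continuous_ofReal.comp hφ) hc'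
      ((hf _ hc'.isCompact).integrable one_le_two)
  have hparts : ∀ {f g f' g' : ℂ → ℂ} {e : ℂ},
      (∀ K : Set ℂ, IsCompact K → MemLp f 2 (volume.restrict K)) →
      (∀ K : Set ℂ, IsCompact K → MemLp g 2 (volume.restrict K)) →
      (∀ K : Set ℂ, IsCompact K → MemLp f' 2 (volume.restrict K)) →
      (∀ K : Set ℂ, IsCompact K → MemLp g' 2 (volume.restrict K)) →
      (∀ φ : ℂ → ℝ, ContDiff ℝ ∞ φ → HasCompactSupport φ →
        ∫ x, ((fderiv ℝ φ x e : ℝ) : ℂ) * f x = -∫ x, (φ x : ℂ) * f' x) →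
      (∀ φ : ℂ → ℝ, ContDiff ℝ ∞ φ → HasCompactSupport φ →
        ∫ x, ((fderiv ℝ φ x e : ℝ) : ℂ) * g x = -∫ x, (φ x : ℂ) * g' x) →
      ∀ φ : ℂ → ℝ, ContDiff ℝ ∞ φ → HasCompactSupport φ →
        ∫ x, fderiv ℝ φ x e * l (g x - f x) = -∫ x, φ x * l (g' x - f' x) := by
    intro f g f' g' e hf hg hf' hg' h1 h2 φ hφ hc
    have hd := continuous_fderiv_apply hφ e
    have hdc := hc.fderiv_apply ℝ e
    simp only [← hl, mul_sub]
    have e1 := (l.integral_comp_comm ((hint hg hd hdc).sub (hint hf hd hdc))).trans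
      (congrArg l (integral_sub (hint hg hd hdc) (hint hf hd hdc)))
    have e2 := (l.integral_comp_comm ((hint hg' hφ.continuous hc).sub
      (hint hf' hφ.continuous hc))).trans
      (congrArg l (integral_sub (hint hg' hφ.continuous hc) (hint hf' hφ.continuous hc)))
    simp only [Pi.sub_apply] at e1 e2
    rw [e1, e2, h1 φ hφ hc, h2 φ hφ hc, ← map_neg]
    congr 1
    ring
  refine ⟨fun x => l (q₁ x - p₁ x), fun x => l (q₂ x - p₂ x), hlin hp.memLp hq.memLp,
    hlin hp.memLp_fst hq.memLp_fst, hlin hp.memLp_snd hq.memLp_snd,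
    hparts hp.memLp hq.memLp hp.memLp_fst hq.memLp_fst hp.integral_fst hq.integral_fst,
    hparts hp.memLp hq.memLp hp.memLp_snd hq.memLp_snd hp.integral_snd hq.integral_snd,
    fun φ hφ hc => ?_⟩
  have hbd : ∀ {f : ℂ → ℂ}, Integrable f → Integrable fun x => (γ x : ℂ) * f x := fun hf =>
    hf.bdd_mul (c := C) (Complex.measurable_ofReal.comp hγ).aestronglyMeasurable
      (ae_of_all _ fun x => by simpa using hC x)
  have hflux : ∀ {g₁ g₂ : ℂ → ℂ}, (∀ K : Set ℂ, IsCompact K → MemLp g₁ 2 (volume.restrict K)) →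
      (∀ K : Set ℂ, IsCompact K → MemLp g₂ 2 (volume.restrict K)) →
      Integrable fun x => (γ x : ℂ) * (g₁ x * ((fderiv ℝ φ x 1 : ℝ) : ℂ)
        + g₂ x * ((fderiv ℝ φ x Complex.I : ℝ) : ℂ)) := fun {g₁ g₂} h1 h2 => by
    refine hbd (Integrable.add ?_ ?_)
    · simpa only [mul_comm] using hint h1 (continuous_fderiv_apply hφ 1) (hc.fderiv_apply ℝ 1)
    · simpa only [mul_comm] using hint h2 (continuous_fderiv_apply hφ Complex.I)
        (hc.fderiv_apply ℝ Complex.I)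
  have h0 := l.integral_comp_comm ((hflux hq.memLp_fst hq.memLp_snd).sub
    (hflux hp.memLp_fst hp.memLp_snd))
  simp only [Pi.sub_apply] at h0
  rw [integral_sub (hflux hq.memLp_fst hq.memLp_snd) (hflux hp.memLp_fst hp.memLp_snd),
    hqw φ hφ hc, hpw φ hφ hc, sub_zero, map_zero] at h0
  rw [← h0]
  refine integral_congr_ae (ae_of_all _ fun x => ?_)
  simp only
  rw [mul_comm (l _), mul_comm (l _), ← hl, ← hl, ← map_add, ← hl]
  congr 1
  ring

/-- Solutions of the conductivity problem are unique. -/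
theorem SolvesConductivityProblem.ae_eq {γ : ℂ → ℝ} {H u v : ℂ → ℂ}
    (hu : SolvesConductivityProblem γ H u) (hv : SolvesConductivityProblem γ H v)
    (hγ : Measurable γ) {c C : ℝ} (hc : 0 < c) (hcγ : ∀ x, c ≤ γ x) (hC : ∀ x, γ x ≤ C) :
    v =ᵐ[volume] u := by
  have hC' : ∀ x, |γ x| ≤ C := fun x => by
    rw [abs_of_nonneg (hc.le.trans (hcγ x))]; exact hC x
  have hO : (fun x => v x - u x) =O[Bornology.cobounded ℂ] fun x => ‖x‖⁻¹ := by
    simpa using hv.decay.sub hu.decay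
  have hl : ∀ l : ℂ →L[ℝ] ℝ, ∀ᵐ x, l (v x - u x) = 0 := fun l => by
    obtain ⟨g₁, g₂, h⟩ := exists_isRealWeakSolution hu.weak hv.weak hγ hC' l
    exact h.ae_eq_zero hγ hc hcγ hC ((l.isBigO_comp _ _).trans hO)
  filter_upwards [hl Complex.reCLM, hl Complex.imCLM] with x h1 h2
  exact sub_eq_zero.1 (Complex.ext h1 h2)

/-! ### Geometry of the layers. -/

/-- The standing assumptions on the conductivities and on the radii. -/
structure IsConfiguration (N : ℕ) (σ r : ℕ → ℝ) : Prop where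
  conductivity_pos : ∀ k ≤ N, 0 < σ k
  conductivity_ne : ∀ k, 1 ≤ k → k ≤ N → σ k ≠ σ (k - 1)
  radius_pos : ∀ k, 1 ≤ k → k ≤ N → 0 < r k
  radius_lt : ∀ k, 1 ≤ k → k < N → r (k + 1) < r k

namespace IsConfiguration

variable {N : ℕ} {σ r : ℕ → ℝ} (hc : IsConfiguration N σ r)
include hc

theorem radius_le_of_le {i j : ℕ} (hi : 1 ≤ i) (hij : i ≤ j) (hj : j ≤ N) : r j ≤ r i := by
  induction j, hij using Nat.le_induction with
  | base => exact le_rfl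
  | succ j hij ih => exact (hc.radius_lt j (by omega) hj).le.trans (ih (by omega))

theorem radius_lt_of_lt {i j : ℕ} (hi : 1 ≤ i) (hij : i < j) (hj : j ≤ N) : r j < r i :=
  (hc.radius_le_of_le (by omega) hij hj).trans_lt (hc.radius_lt i hi (by omega))

theorem radius_succ_pos (j : Fin N) : 0 < r (j + 1) := hc.radius_pos _ (by omega) (by omega)

theorem norm_le_iff_of_mem_layer {m : ℕ} {z : ℂ} (hz : z ∈ layer N r m) (hm : m ≤ N)
    (j : Fin N) : ‖z‖ ≤ r (j + 1) ↔ (j : ℕ) < m := by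
  constructor
  · intro h
    by_contra hjm
    have h1 := hz.2 (by omega)
    have h2 := hc.radius_le_of_le (i := m + 1) (j := j + 1) (by omega) (by omega) (by omega)
    linarith
  · intro h
    exact (hz.1 (by omega)).trans (hc.radius_le_of_le (by omega) h hm)

theorem conductivity_eq_of_mem_layer {m : ℕ} {z : ℂ} (hz : z ∈ layer N r m) (hm : m ≤ N) :
    conductivity N σ r z = σ m := by
  rw [conductivity, Finset.sum_eq_single m]
  · exact Set.indicator_of_mem hz _
  · intro k hk hkm
    refine Set.indicator_of_notMem (fun hzk => ?_) _
    rw [Finset.mem_range] at hk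
    rcases Nat.lt_or_gt_of_ne hkm with h | h
    · have h1 := (hc.norm_le_iff_of_mem_layer hz hm ⟨k, by omega⟩).2 h
      exact (hzk.2 (by omega)).not_ge h1
    · have h1 := (hc.norm_le_iff_of_mem_layer hzk (by omega) ⟨m, by omega⟩).2 h
      exact (hz.2 (by omega)).not_ge h1
  · intro h; simp at h; omega

omit hc in
theorem exists_mem_layer (z : ℂ) : ∃ m ≤ N, z ∈ layer N r m := by
  classical
  by_cases h : ∃ j, j < N ∧ r (j + 1) < ‖z‖
  · refine ⟨Nat.find h, (Nat.find_spec h).1.le, fun hm => ?_, fun _ => (Nat.find_spec h).2⟩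
    have := Nat.find_min h (m := Nat.find h - 1) (by omega)
    have hlt := (Nat.find_spec h).1
    rw [not_and, not_lt, Nat.sub_add_cancel hm] at this
    exact this (by omega)
  · push Not at h
    refine ⟨N, le_rfl, fun hN => ?_, fun h => absurd h (lt_irrefl _)⟩
    simpa [Nat.sub_add_cancel hN] using h (N - 1) (by omega)

theorem exists_conductivity_bounds :
    ∃ c C, 0 < c ∧ (∀ z, c ≤ conductivity N σ r z) ∧ ∀ z, conductivity N σ r z ≤ C := by
  have hne : (Finset.range (N + 1)).Nonempty := ⟨0, by simp⟩
  refine ⟨(Finset.range (N + 1)).inf' hne σ, (Finset.range (N + 1)).sup' hne σ, ?_, fun z => ?_,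
    fun z => ?_⟩
  · rw [Finset.lt_inf'_iff]
    intro k hk
    exact hc.conductivity_pos k (by simpa [Nat.lt_succ_iff] using hk)
  all_goals
    obtain ⟨m, hm, hz⟩ := exists_mem_layer (N := N) (r := r) z
    rw [hc.conductivity_eq_of_mem_layer hz hm]
  · exact Finset.inf'_le _ (by simpa [Nat.lt_succ_iff] using hm)
  · exact Finset.le_sup' _ (by simpa [Nat.lt_succ_iff] using hm)

omit hc in
theorem measurable_conductivity : Measurable (conductivity N σ r) := by
  unfold conductivity
  refine Finset.measurable_sum _ fun k _ => measurable_const.indicator ?_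
  refine ((MeasurableSet.const _).imp (measurableSet_le measurable_norm measurable_const)).inter
    ((MeasurableSet.const _).imp (measurableSet_lt measurable_const measurable_norm))

omit hc in
-- Off the circles the comparisons of ‖y‖ with the radii persist nearby, which makes the
-- conductivity locally constant.
theorem conductivity_congr {y z : ℂ} (h : ∀ j : Fin N, ‖y‖ ≤ r (j + 1) ↔ ‖z‖ ≤ r (j + 1)) :
    conductivity N σ r y = conductivity N σ r z := by
  refine Finset.sum_congr rfl fun k hk => ?_
  rw [Finset.mem_range] at hk
  have : y ∈ layer N r k ↔ z ∈ layer N r k := by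
    refine and_congr (forall_congr' fun hk1 => ?_) (forall_congr' fun hkN => ?_)
    · have := h ⟨k - 1, by omega⟩
      rwa [Nat.sub_add_cancel hk1] at this
    · rw [← not_le, ← not_le]
      exact not_congr (h ⟨k, hkN⟩)
  by_cases hy : y ∈ layer N r k
  · rw [Set.indicator_of_mem hy, Set.indicator_of_mem (this.1 hy)]
  · rw [Set.indicator_of_notMem hy, Set.indicator_of_notMem (mt this.2 hy)]

end IsConfiguration

/-! ### Reflection in a circle. -/

section Reflection

/-- The map that is the identity in the disk of radius `ρ` and the reflection in its boundary
outside. -/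
noncomputable def fold (ρ : ℝ) (z : ℂ) : ℂ := (((ρ / max ρ ‖z‖) ^ 2 : ℝ) : ℂ) * z

variable {ρ : ℝ} {z : ℂ} {W : ℂ → ℂ}

theorem fold_of_le (hρ : 0 < ρ) (h : ‖z‖ ≤ ρ) : fold ρ z = z := by
  simp [fold, max_eq_left h, div_self hρ.ne']

theorem fold_of_ge (h : ρ ≤ ‖z‖) : fold ρ z = (((ρ / ‖z‖) ^ 2 : ℝ) : ℂ) * z := by
  rw [fold, max_eq_right h]

/-- Shows the outer branch as antiholomorphic, so that W ∘ `fold ρ` is harmonic on both sides of the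
circle. -/
theorem fold_eq_div_conj (h : ρ ≤ ‖z‖) (hρ : 0 < ρ) :
    fold ρ z = (ρ : ℂ) ^ 2 / (starRingEnd ℂ) z := by
  have hz : z ≠ 0 := norm_pos_iff.1 (hρ.trans_le h)
  have hz' : (starRingEnd ℂ) z ≠ 0 := (map_ne_zero _).2 hz
  have hn : (‖z‖ : ℂ) ≠ 0 := by exact_mod_cast (norm_pos_iff.2 hz).ne'
  rw [fold_of_ge h]
  push_cast
  rw [eq_div_iff hz', mul_assoc, Complex.mul_conj', div_pow, div_mul_cancel₀ _ (pow_ne_zero 2 hn)]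

theorem continuous_fold (hρ : 0 < ρ) : Continuous (fold ρ) := by
  have h : ∀ z : ℂ, max ρ ‖z‖ ≠ 0 := fun z => (hρ.trans_le (le_max_left _ _)).ne'
  exact (Complex.continuous_ofReal.comp ((continuous_const.div
    (continuous_const.max continuous_norm) h).pow 2)).mul continuous_id

/-- The real-linear map `e ↦ A e + B ē`. -/
noncomputable def wirtinger (A B : ℂ) : ℂ →L[ℝ] ℂ :=
  A • ContinuousLinearMap.id ℝ ℂ + B • (Complex.conjCLE : ℂ →L[ℝ] ℂ)

theorem wirtinger_apply (A B e : ℂ) : wirtinger A B e = A * e + B * (starRingEnd ℂ) e := rfl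

theorem norm_wirtinger_le (A B : ℂ) : ‖wirtinger A B‖ ≤ ‖A‖ + ‖B‖ := by
  refine ContinuousLinearMap.opNorm_le_bound _ (by positivity) fun e => ?_
  rw [wirtinger_apply, add_mul]
  refine (norm_add_le _ _).trans ?_
  rw [norm_mul, norm_mul, RCLike.norm_conj]

theorem hasFDerivAt_wirtinger {c : ℂ} (h : HasDerivAt W c z) :
    HasFDerivAt W (wirtinger c 0) z := by
  refine h.complexToReal_fderiv.congr_fderiv ?_
  ext e; simp [wirtinger_apply]

/-- The coefficient of `dz` in the differential of `W ∘ fold ρ`. -/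
noncomputable def dzCoeff (ρ : ℝ) (W : ℂ → ℂ) (z : ℂ) : ℂ := if ‖z‖ ≤ ρ then deriv W z else 0

/-- The coefficient of `dz̄` in the differential of `W ∘ fold ρ`. -/
noncomputable def dzbarCoeff (ρ : ℝ) (W : ℂ → ℂ) (z : ℂ) : ℂ :=
  if ‖z‖ ≤ ρ then 0 else -(deriv W (fold ρ z) * ((ρ : ℂ) ^ 2 / (starRingEnd ℂ) z ^ 2))

theorem hasFDerivAt_comp_fold (hρ : 0 < ρ) (hW : Differentiable ℂ W) (hz : ‖z‖ ≠ ρ) :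
    HasFDerivAt (fun z => W (fold ρ z)) (wirtinger (dzCoeff ρ W z) (dzbarCoeff ρ W z)) z := by
  rcases lt_or_gt_of_ne hz with h | h
  · rw [dzCoeff, dzbarCoeff, if_pos h.le, if_pos h.le]
    refine (hasFDerivAt_wirtinger (hW z).hasDerivAt).congr_of_eventuallyEq ?_
    filter_upwards [continuous_norm.continuousAt.eventually_lt_const h] with y hy
    rw [fold_of_le hρ hy.le]
  · rw [dzCoeff, dzbarCoeff, if_neg h.not_ge, if_neg h.not_ge]
    have hz0 : z ≠ 0 := norm_pos_iff.1 (hρ.trans h)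
    have hz' : (starRingEnd ℂ) z ≠ 0 := (map_ne_zero _).2 hz0
    have h1 : HasDerivAt (fun y : ℂ => W ((ρ : ℂ) ^ 2 / y))
        (-(deriv W (fold ρ z) * ((ρ : ℂ) ^ 2 / (starRingEnd ℂ) z ^ 2))) ((starRingEnd ℂ) z) := by
      have h2 : HasDerivAt (fun y : ℂ => (ρ : ℂ) ^ 2 / y)
          (-((ρ : ℂ) ^ 2 / (starRingEnd ℂ) z ^ 2)) ((starRingEnd ℂ) z) := by
        simpa [div_eq_mul_inv] using (hasDerivAt_inv hz').const_mul ((ρ : ℂ) ^ 2)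
      rw [fold_eq_div_conj h.le hρ, ← mul_neg]
      exact (hW _).hasDerivAt.comp _ h2
    have h3 := (hasFDerivAt_wirtinger h1).comp z
      (Complex.conjCLE : ℂ →L[ℝ] ℂ).hasFDerivAt
    refine (h3.congr_fderiv ?_).congr_of_eventuallyEq ?_
    · ext e
      simp [wirtinger_apply]
    · filter_upwards [continuous_norm.continuousAt.eventually_const_lt h] with y hy
      rw [fold_eq_div_conj hy.le hρ]
      rfl

/-- Only one coefficient is nonzero at a time, and the outer factor ρ²/z̄² has modulus at most 1.
The right side is continuous in z, as the bound in `IsPiecewiseSmooth` must be. -/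
theorem norm_coeff_add_le (hρ : 0 < ρ) :
    ‖dzCoeff ρ W z‖ + ‖dzbarCoeff ρ W z‖ ≤ ‖deriv W (fold ρ z)‖ := by
  by_cases h : ‖z‖ ≤ ρ
  · rw [dzCoeff, dzbarCoeff, if_pos h, if_pos h, fold_of_le hρ h]; simp
  · rw [dzCoeff, dzbarCoeff, if_neg h, if_neg h]
    have h' := not_le.1 h
    have hz0 : 0 < ‖z‖ := hρ.trans h'
    have h1 : ‖(ρ : ℂ) ^ 2 / (starRingEnd ℂ) z ^ 2‖ ≤ 1 := by
      rw [norm_div, norm_pow, norm_pow, RCLike.norm_conj, Complex.norm_real,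
        Real.norm_of_nonneg hρ.le]
      exact div_le_one_of_le₀ (by gcongr) (by positivity)
    rw [norm_zero, zero_add, norm_neg, norm_mul]
    exact mul_le_of_le_one_right (norm_nonneg _) h1

theorem eventually_norm_le_iff (hz : ‖z‖ ≠ ρ) : ∀ᶠ y in 𝓝 z, (‖y‖ ≤ ρ ↔ ‖z‖ ≤ ρ) := by
  rcases lt_or_gt_of_ne hz with h | h
  · filter_upwards [continuous_norm.continuousAt.eventually_lt_const h] with y hy
    exact iff_of_true hy.le h.le
  · filter_upwards [continuous_norm.continuousAt.eventually_const_lt h] with y hy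
    exact iff_of_false (not_le.2 hy) (not_le.2 h)

end Reflection

/-! ### The solution built from potentials, and its stream function. -/

/-- Entire functions `W₁, …, W_N` such that `H + ∑ W_k ∘ fold r_k` solves the transmission
problem. -/
structure IsPotential (N : ℕ) (σ r : ℕ → ℝ) (H : ℂ → ℂ) (W : Fin N → ℂ → ℂ) : Prop where
  differentiable_source : Differentiable ℂ H
  differentiable : ∀ j, Differentiable ℂ (W j)
  map_zero : ∀ j, W j 0 = 0
  -- All degrees at once: scaling the argument by (r_j/r_i)² multiplies the coefficient of degree n
  -- by (r_j/r_i)²ⁿ, the entry of 𝕄⁽ⁿ⁾.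
  row : ∀ (i : Fin N) (x : ℂ), ∑ j : Fin N, (if i = j then ((-2 * contrast σ (i + 1) : ℝ) : ℂ) * W i x
    else if i < j then W j ((((r (j + 1) / r (i + 1)) ^ 2 : ℝ) : ℂ) * x) else -W j x) = H x

/-- Balance of fluxes across an interface. -/
theorem flux_balance {N : ℕ} {σ : ℕ → ℝ} (hσ : ∀ k, 1 ≤ k → k ≤ N → σ k ≠ σ (k - 1)) (i : Fin N)
    {A B : Fin N → ℂ} {h : ℂ} (hAB : A i = B i)
    (hrow : ∑ j : Fin N, (if i = j then ((-2 * contrast σ (i + 1) : ℝ) : ℂ) * A i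
      else if i < j then B j else -A j) = h) :
    (σ i : ℂ) * (h + ∑ j : Fin N, if (j : ℕ) < i then A j else -B j) =
      (σ (i + 1) : ℂ) * (h + ∑ j : Fin N, if (j : ℕ) < i + 1 then A j else -B j) := by
  have h1 := two_mul_contrast_mul (hσ (i + 1) (by omega) (by omega))
  have h2 : 2 * (contrast σ (i + 1) : ℂ) * ((σ (i + 1) : ℂ) - σ i) = σ (i + 1) + σ i := by
    simp only [Nat.add_sub_cancel] at h1
    exact_mod_cast h1
  -- Eliminating h turns the two sides into σ_i(−2λ − 1)A_i and σ_{i+1}(−2λ + 1)A_i, equal by the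
  -- definition of the contrast λ.
  rw [sum_row_eq] at hrow
  rw [sum_ite_lt_succ, ← hrow, ← hAB]
  push_cast
  linear_combination A i * h2

variable {N : ℕ} {σ r : ℕ → ℝ} {H : ℂ → ℂ} {W : Fin N → ℂ → ℂ}

/-- The solution of the conductivity problem in terms of its potentials. -/
noncomputable def solution (r : ℕ → ℝ) (H : ℂ → ℂ) (W : Fin N → ℂ → ℂ) (z : ℂ) : ℂ :=
  H z + ∑ j : Fin N, W j (fold (r (j + 1)) z)

/-- The stream function of the solution. -/
noncomputable def stream (σ r : ℕ → ℝ) (H : ℂ → ℂ) (W : Fin N → ℂ → ℂ) (z : ℂ) : ℂ :=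
  -Complex.I * conductivity N σ r z *
    (H z + ∑ j : Fin N, (if ‖z‖ ≤ r (j + 1) then 1 else -1) * W j (fold (r (j + 1)) z))

/-- The radii of the interfaces. -/
noncomputable def radii (N : ℕ) (r : ℕ → ℝ) : Finset ℝ :=
  Finset.univ.image fun j : Fin N => r (j + 1)

theorem norm_ne_of_notMem_radii {t : ℝ} (h : t ∉ radii N r) (j : Fin N) : t ≠ r (j + 1) := by
  rintro rfl
  exact h (Finset.mem_image_of_mem _ (Finset.mem_univ j))

namespace IsPotential

variable (hp : IsPotential N σ r H W) (hc : IsConfiguration N σ r)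
include hp hc

theorem continuous_comp_fold (j : Fin N) : Continuous fun z => W j (fold (r (j + 1)) z) :=
  (hp.differentiable j).continuous.comp (continuous_fold (hc.radius_succ_pos j))

theorem continuous_solution : Continuous (solution r H W) :=
  hp.differentiable_source.continuous.add
    (continuous_finsetSum _ fun j _ => hp.continuous_comp_fold hc j)

theorem hasFDerivAt_solution {z : ℂ} (hz : ‖z‖ ∉ radii N r) :
    HasFDerivAt (solution r H W) (wirtinger (deriv H z + ∑ j : Fin N, dzCoeff (r (j + 1)) (W j) z)
      (∑ j : Fin N, dzbarCoeff (r (j + 1)) (W j) z)) z := by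
  have h1 := hasFDerivAt_wirtinger (hp.differentiable_source z).hasDerivAt
  have h2 := HasFDerivAt.fun_sum (u := Finset.univ) fun j _ =>
    hasFDerivAt_comp_fold (hc.radius_succ_pos j) (hp.differentiable j)
      (norm_ne_of_notMem_radii hz j)
  refine (h1.add h2).congr_fderiv ?_
  ext e
  simp only [add_apply, sum_apply, wirtinger_apply, Finset.sum_add_distrib,
    add_mul, Finset.sum_mul]
  ring

/-- Conjugation multiplies holomorphic parts by −i and antiholomorphic parts by i. Against the
differential of the solution, the dz̄ coefficient changes sign, which is the rotation by a right
angle. -/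
theorem hasFDerivAt_stream {z : ℂ} (hz : ‖z‖ ∉ radii N r) :
    HasFDerivAt (stream σ r H W) ((-Complex.I * conductivity N σ r z) •
      wirtinger (deriv H z + ∑ j : Fin N, dzCoeff (r (j + 1)) (W j) z)
        (-∑ j : Fin N, dzbarCoeff (r (j + 1)) (W j) z)) z := by
  have h1 := hasFDerivAt_wirtinger (hp.differentiable_source z).hasDerivAt
  have h2 := HasFDerivAt.fun_sum (u := Finset.univ) fun j _ =>
    (hasFDerivAt_comp_fold (hc.radius_succ_pos j) (hp.differentiable j)
      (norm_ne_of_notMem_radii hz j)).const_mul (if ‖z‖ ≤ r (j + 1) then (1 : ℂ) else -1)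
  refine (((h1.add h2).const_mul (-Complex.I * conductivity N σ r z)).congr_fderiv ?_).congr_of_eventuallyEq ?_
  · ext e
    have h3 : ∀ j : Fin N, (if ‖z‖ ≤ r (j + 1) then (1 : ℂ) else -1) *
        (wirtinger (dzCoeff (r (j + 1)) (W j) z) (dzbarCoeff (r (j + 1)) (W j) z) e) =
        dzCoeff (r (j + 1)) (W j) z * e + -dzbarCoeff (r (j + 1)) (W j) z * (starRingEnd ℂ) e := by
      intro j
      rw [wirtinger_apply, dzCoeff, dzbarCoeff]
      split_ifs <;> ring
    simp only [add_apply, smul_apply, sum_apply, smul_eq_mul, h3]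
    simp only [wirtinger_apply, Finset.sum_add_distrib, ← Finset.sum_mul, Finset.sum_neg_distrib]
    ring
  · filter_upwards [eventually_all.2 fun j : Fin N =>
      eventually_norm_le_iff (norm_ne_of_notMem_radii hz j)] with y hy
    rw [stream, IsConfiguration.conductivity_congr hy]
    simp only [hy]
    rfl

omit hp in
theorem stream_eq_of_mem_layer {m : ℕ} (hm : m ≤ N) {z : ℂ} (hz : z ∈ layer N r m) :
    stream σ r H W z = -Complex.I * ((σ m : ℂ) * (H z + ∑ j : Fin N,
      if (j : ℕ) < m then W j (fold (r (j + 1)) z) else -W j (fold (r (j + 1)) z))) := by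
  rw [stream, hc.conductivity_eq_of_mem_layer hz hm, mul_assoc]
  congr 3
  refine Finset.sum_congr rfl fun j _ => ?_
  simp only [hc.norm_le_iff_of_mem_layer hz hm j]
  split_ifs <;> simp

omit hp in
theorem fold_of_norm_eq_of_le {i j : Fin N} {x : ℂ} (hx : ‖x‖ = r (i + 1)) (hji : j ≤ i) :
    fold (r (j + 1)) x = x := by
  refine fold_of_le (hc.radius_succ_pos j) (hx ▸ hc.radius_le_of_le (by omega) ?_ (by omega))
  exact Nat.succ_le_succ hji

omit hp in
theorem fold_of_norm_eq_of_ge {i j : Fin N} {x : ℂ} (hx : ‖x‖ = r (i + 1)) (hij : i ≤ j) :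
    fold (r (j + 1)) x = (((r (j + 1) / r (i + 1)) ^ 2 : ℝ) : ℂ) * x := by
  rw [fold_of_ge, hx]
  exact hx ▸ hc.radius_le_of_le (by omega) (Nat.succ_le_succ hij) (by omega)

/-- On the i-th circle the folds of the circles enclosing it are the identity and those of the
smaller circles scale by (r_j/r_i)², so this is the row equation in the form of `flux_balance`. -/
theorem stream_balance (i : Fin N) {x : ℂ} (hx : ‖x‖ = r (i + 1)) :
    (σ i : ℂ) * (H x + ∑ j : Fin N,
      if (j : ℕ) < i then W j (fold (r (j + 1)) x) else -W j (fold (r (j + 1)) x)) =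
    (σ (i + 1) : ℂ) * (H x + ∑ j : Fin N,
      if (j : ℕ) < i + 1 then W j (fold (r (j + 1)) x) else -W j (fold (r (j + 1)) x)) := by
  have h := flux_balance hc.conductivity_ne i (A := fun j => W j x)
    (B := fun j => W j ((((r (j + 1) / r (i + 1)) ^ 2 : ℝ) : ℂ) * x))
    (by simp [div_self (hc.radius_succ_pos i).ne']) (hp.row i x)
  convert h using 4 with j _ j _
  · split_ifs with hji
    · rw [fold_of_norm_eq_of_le hc hx (le_of_lt hji)]
    · rw [fold_of_norm_eq_of_ge hc hx (not_lt.1 hji)]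
  · split_ifs with hji
    · rw [fold_of_norm_eq_of_le hc hx (Nat.lt_succ_iff.1 hji)]
    · rw [fold_of_norm_eq_of_ge hc hx (le_of_lt (not_le.1 (mt Nat.lt_succ_of_le hji)))]

theorem continuous_stream : Continuous (stream σ r H W) := by
  -- The closed layers are a finite closed cover, and on each the stream function is given by one
  -- continuous formula. On the inner boundary circle the definition uses the next layer's formula,
  -- which agrees by `stream_balance`.
  let C : Fin (N + 1) → Set ℂ := fun m =>
    {z | (1 ≤ (m : ℕ) → ‖z‖ ≤ r m) ∧ ((m : ℕ) < N → r (m + 1) ≤ ‖z‖)}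
  refine (locallyFinite_of_finite C).continuous ?_ (fun m => ?_) fun m => ?_
  · refine Set.eq_univ_of_forall fun z => ?_
    obtain ⟨m, hm, hz⟩ := IsConfiguration.exists_mem_layer (N := N) (r := r) z
    exact Set.mem_iUnion.2 ⟨⟨m, by omega⟩, hz.1, fun h => (hz.2 h).le⟩
  · have hC : C m = (⋂ _ : 1 ≤ (m : ℕ), {z : ℂ | ‖z‖ ≤ r m}) ∩
        ⋂ _ : (m : ℕ) < N, {z : ℂ | r (m + 1) ≤ ‖z‖} := by ext z; simp [C]
    rw [hC]
    exact (isClosed_iInter fun _ => isClosed_le continuous_norm continuous_const).inter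
      (isClosed_iInter fun _ => isClosed_le continuous_const continuous_norm)
  · have hcont : Continuous fun z => -Complex.I * ((σ m : ℂ) * (H z + ∑ j : Fin N,
        if (j : ℕ) < m then W j (fold (r (j + 1)) z) else -W j (fold (r (j + 1)) z))) := by
      refine continuous_const.mul (continuous_const.mul
        (hp.differentiable_source.continuous.add (continuous_finsetSum _ fun j _ => ?_)))
      split_ifs
      · exact hp.continuous_comp_fold hc j
      · exact (hp.continuous_comp_fold hc j).neg
    refine hcont.continuousOn.congr fun z hz => ?_
    by_cases hlay : z ∈ layer N r m
    · exact stream_eq_of_mem_layer hc (Nat.lt_succ_iff.1 m.2) hlay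
    · have hmN : (m : ℕ) < N ∧ ‖z‖ ≤ r (m + 1) := by
        by_contra hcon
        refine hlay ⟨hz.1, fun h => ?_⟩
        by_contra hle
        exact hcon ⟨h, not_lt.1 hle⟩
      have hx : ‖z‖ = r (m + 1) := le_antisymm hmN.2 (hz.2 hmN.1)
      have hlay' : z ∈ layer N r (m + 1) :=
        ⟨fun _ => hx.le, fun h => hx ▸ hc.radius_lt (m + 1) (by omega) h⟩
      rw [stream_eq_of_mem_layer hc hmN.1 hlay']
      exact congrArg _ (hp.stream_balance hc ⟨m, hmN.1⟩ hx).symm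

theorem continuous_deriv_bound :
    Continuous fun z => ‖deriv H z‖ + ∑ j : Fin N, ‖deriv (W j) (fold (r (j + 1)) z)‖ := by
  have hd : ∀ {f : ℂ → ℂ}, Differentiable ℂ f → Continuous (deriv f) := fun hf =>
    (hf.contDiff (n := 1)).continuous_deriv le_rfl
  refine (hd hp.differentiable_source).norm.add (continuous_finsetSum _ fun j _ => ?_)
  exact ((hd (hp.differentiable j)).comp (continuous_fold (hc.radius_succ_pos j))).norm

omit hp in
theorem norm_coeff_le (z : ℂ) :
    ‖deriv H z + ∑ j : Fin N, dzCoeff (r (j + 1)) (W j) z‖ + ‖∑ j : Fin N, dzbarCoeff (r (j + 1)) (W j) z‖ ≤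
      ‖deriv H z‖ + ∑ j : Fin N, ‖deriv (W j) (fold (r (j + 1)) z)‖ := by
  have h1 := norm_add_le (deriv H z) (∑ j : Fin N, dzCoeff (r (j + 1)) (W j) z)
  have h2 := norm_sum_le Finset.univ fun j : Fin N => dzCoeff (r (j + 1)) (W j) z
  have h3 := norm_sum_le Finset.univ fun j : Fin N => dzbarCoeff (r (j + 1)) (W j) z
  have h4 := Finset.sum_le_sum fun (j : Fin N) (_ : j ∈ Finset.univ) =>
    norm_coeff_add_le (W := W j) (z := z) (hc.radius_succ_pos j)
  rw [Finset.sum_add_distrib] at h4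
  linarith

omit hp in
theorem radii_ne_zero : ∀ s ∈ radii N r, s ≠ 0 := by
  intro s hs
  obtain ⟨j, -, rfl⟩ := Finset.mem_image.1 hs
  exact (hc.radius_succ_pos j).ne'

theorem isPiecewiseSmooth_solution : IsPiecewiseSmooth (radii N r)
    (fun z => ‖deriv H z‖ + ∑ j : Fin N, ‖deriv (W j) (fold (r (j + 1)) z)‖) (solution r H W) where
  ne_zero := radii_ne_zero hc
  continuous := hp.continuous_solution hc
  differentiableAt _ hz := (hp.hasFDerivAt_solution hc hz).differentiableAt
  continuous_bound := hp.continuous_deriv_bound hc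
  norm_fderiv_le z hz := by
    rw [(hp.hasFDerivAt_solution hc hz).fderiv]
    exact (norm_wirtinger_le _ _).trans (norm_coeff_le hc z)

theorem exists_isPiecewiseSmooth_stream :
    ∃ K, IsPiecewiseSmooth (radii N r) K (stream σ r H W) := by
  obtain ⟨c, C, hc0, hcγ, hC⟩ := hc.exists_conductivity_bounds
  refine ⟨fun z => C * (‖deriv H z‖ + ∑ j : Fin N, ‖deriv (W j) (fold (r (j + 1)) z)‖), radii_ne_zero hc,
    hp.continuous_stream hc, fun z hz => (hp.hasFDerivAt_stream hc hz).differentiableAt,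
    continuous_const.mul (hp.continuous_deriv_bound hc), fun z hz => ?_⟩
  rw [(hp.hasFDerivAt_stream hc hz).fderiv, norm_smul, norm_mul, norm_neg, Complex.norm_I, one_mul,
    Complex.norm_real, Real.norm_of_nonneg (hc0.le.trans (hcγ z))]
  have h1 := (norm_wirtinger_le (deriv H z + ∑ j : Fin N, dzCoeff (r (j + 1)) (W j) z)
        (-∑ j : Fin N, dzbarCoeff (r (j + 1)) (W j) z))
  rw [norm_neg] at h1
  exact mul_le_mul (hC z) (h1.trans (norm_coeff_le hc z)) (norm_nonneg _)
    (hc0.le.trans ((hcγ z).trans (hC z)))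

theorem isWeakSolution_solution : IsWeakSolution (conductivity N σ r) (solution r H W) := by
  obtain ⟨K, hK⟩ := hp.exists_isPiecewiseSmooth_stream hc
  refine (hp.isPiecewiseSmooth_solution hc).isWeakSolution hK (fun z hz => ?_) fun z hz => ?_
  all_goals
    rw [(hp.hasFDerivAt_solution hc hz).fderiv, (hp.hasFDerivAt_stream hc hz).fderiv]
    simp only [smul_apply, wirtinger_apply, smul_eq_mul, map_one, Complex.conj_I]
  · linear_combination ((conductivity N σ r z : ℂ) * (deriv H z +
      ∑ j : Fin N, dzCoeff (r (j + 1)) (W j) z + ∑ j : Fin N, dzbarCoeff (r (j + 1)) (W j) z)) * Complex.I_mul_I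
  · ring

/-- Each fold tends to 0 like 1/|z|, and W_j is differentiable at 0 with W_j(0) = 0. -/
theorem solution_sub_isBigO :
    (fun z => solution r H W z - H z) =O[Bornology.cobounded ℂ] fun z => ‖z‖⁻¹ := by
  simp only [solution, add_sub_cancel_left]
  refine Asymptotics.IsBigO.fun_sum fun j _ => ?_
  have hρ := hc.radius_succ_pos j
  have hev : ∀ᶠ z in Bornology.cobounded ℂ, ‖fold (r (j + 1)) z‖ = r (j + 1) ^ 2 * ‖z‖⁻¹ := by
    filter_upwards [tendsto_norm_cobounded_atTop.eventually_ge_atTop (r (j + 1))] with z hz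
    rw [fold_eq_div_conj hz hρ, norm_div, norm_pow, RCLike.norm_conj, Complex.norm_real,
      Real.norm_of_nonneg hρ.le, div_eq_mul_inv]
  have h1 : fold (r (j + 1)) =O[Bornology.cobounded ℂ] fun z => ‖z‖⁻¹ :=
    .of_bound (r (j + 1) ^ 2) (hev.mono fun z hz => by rw [hz, norm_inv, norm_norm])
  have h2 : Tendsto (fold (r (j + 1))) (Bornology.cobounded ℂ) (𝓝 0) :=
    h1.trans_tendsto (tendsto_inv_atTop_zero.comp tendsto_norm_cobounded_atTop)
  have h3 := (hp.differentiable j 0).isBigO_sub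
  simp only [hp.map_zero j, sub_zero] at h3
  exact (h3.comp_tendsto h2).trans h1

theorem solvesConductivityProblem :
    SolvesConductivityProblem (conductivity N σ r) H (solution r H W) :=
  ⟨hp.isWeakSolution_solution hc, hp.solution_sub_isBigO hc⟩

end IsPotential

/-! ### Transmission conditions. -/

variable {N : ℕ} {σ r : ℕ → ℝ} {H : ℂ → ℂ} {W : Fin N → ℂ → ℂ}

/-- The radial derivative on the `m`-th layer, at the point `t ν`. -/
noncomputable def radialDeriv (r : ℕ → ℝ) (H : ℂ → ℂ) (W : Fin N → ℂ → ℂ) (m : ℕ) (ν : ℂ) (t : ℝ) :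
    ℂ :=
  (deriv H (t * ν) + ∑ j : Fin N, if (j : ℕ) < m then deriv (W j) (t * ν)
    else -((((r (j + 1) / t) ^ 2 : ℝ) : ℂ) * deriv (W j) (fold (r (j + 1)) (t * ν)))) * ν

/-- The radius `t` lies in the interior of the `m`-th layer. -/
def IsInnerRadius (N : ℕ) (r : ℕ → ℝ) (m : ℕ) (t : ℝ) : Prop :=
  ∀ j : Fin N, if (j : ℕ) < m then t < r (j + 1) else r (j + 1) < t

theorem IsInnerRadius.notMem_radii {m : ℕ} {t : ℝ} (h : IsInnerRadius N r m t) :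
    t ∉ radii N r := by
  intro hmem
  obtain ⟨j, -, rfl⟩ := Finset.mem_image.1 hmem
  have := h j
  split_ifs at this <;> exact lt_irrefl _ this

theorem IsInnerRadius.le_iff {m : ℕ} {t : ℝ} (h : IsInnerRadius N r m t) (j : Fin N) :
    t ≤ r (j + 1) ↔ (j : ℕ) < m := by
  have := h j
  split_ifs at this with hj
  · exact iff_of_true this.le hj
  · exact iff_of_false this.not_ge hj

namespace IsConfiguration

variable (hc : IsConfiguration N σ r)
include hc

theorem eventually_isInnerRadius_outer (i : Fin N) :
    ∀ᶠ h : ℝ in 𝓝[>] 0, IsInnerRadius N r i (r (i + 1) + h) := by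
  refine eventually_all.2 fun j => ?_
  split_ifs with hj
  · have h1 := hc.radius_lt_of_lt (i := j + 1) (j := i + 1) (by omega) (by omega) (by omega)
    have h2 : Tendsto (fun h : ℝ => r (i + 1) + h) (𝓝[>] 0) (𝓝 (r (i + 1) + 0)) :=
      (tendsto_const_nhds.add tendsto_id).mono_left nhdsWithin_le_nhds
    exact h2.eventually_lt_const (by simpa using h1)
  · have h1 := hc.radius_le_of_le (i := i + 1) (j := j + 1) (by omega) (by omega) (by omega)
    filter_upwards [self_mem_nhdsWithin] with h hh
    have : 0 < h := hh
    linarith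

theorem eventually_isInnerRadius_inner (i : Fin N) :
    ∀ᶠ h : ℝ in 𝓝[>] 0, IsInnerRadius N r (i + 1) (r (i + 1) - h) := by
  refine eventually_all.2 fun j => ?_
  split_ifs with hj
  · have h1 := hc.radius_le_of_le (i := j + 1) (j := i + 1) (by omega) (by omega) (by omega)
    filter_upwards [self_mem_nhdsWithin] with h hh
    have : 0 < h := hh
    linarith
  · have h1 := hc.radius_lt_of_lt (i := i + 1) (j := j + 1) (by omega) (by omega) (by omega)
    have h2 : Tendsto (fun h : ℝ => r (i + 1) - h) (𝓝[>] 0) (𝓝 (r (i + 1) - 0)) :=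
      (tendsto_const_nhds.sub tendsto_id).mono_left nhdsWithin_le_nhds
    exact h2.eventually_const_lt (by simpa using h1)

end IsConfiguration

namespace IsPotential

variable (hp : IsPotential N σ r H W) (hc : IsConfiguration N σ r)
include hp hc

theorem fderiv_solution_radial {m : ℕ} {ν : ℂ} (hν : ‖ν‖ = 1) {t : ℝ} (ht : 0 < t)
    (h : IsInnerRadius N r m t) :
    fderiv ℝ (solution r H W) (t * ν) ν = radialDeriv r H W m ν t := by
  have hnorm : ‖(t : ℂ) * ν‖ = t := by
    rw [norm_mul, hν, mul_one, Complex.norm_real, Real.norm_of_nonneg ht.le]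
  have hν0 : ν ≠ 0 := norm_ne_zero_iff.1 (by rw [hν]; exact one_ne_zero)
  have hν0' : (starRingEnd ℂ) ν ≠ 0 := (map_ne_zero _).2 hν0
  have hνν : ν * (starRingEnd ℂ) ν = 1 := by rw [Complex.mul_conj', hν]; simp
  have ht0 : (t : ℂ) ≠ 0 := by exact_mod_cast ht.ne'
  rw [(hp.hasFDerivAt_solution hc (by rw [hnorm]; exact h.notMem_radii)).fderiv, wirtinger_apply,
    radialDeriv, add_mul, add_mul, add_assoc, Finset.sum_mul, Finset.sum_mul, Finset.sum_mul,
    ← Finset.sum_add_distrib]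
  congr 1
  refine Finset.sum_congr rfl fun j _ => ?_
  simp only [dzCoeff, dzbarCoeff, hnorm, h.le_iff j]
  split_ifs with hj
  · ring
  · simp only [map_mul, Complex.conj_ofReal]
    generalize deriv (W j) (fold (r (j + 1)) (t * ν)) = d
    push_cast
    field_simp
    linear_combination (d * (r (j + 1) : ℂ) ^ 2) * hνν

/-- The formula of a layer makes sense beyond it, so the one-sided limits of the normal derivative
are its values on the circle. -/
theorem continuousAt_radialDeriv (m : ℕ) (ν : ℂ) {t : ℝ} (ht : 0 < t) :
    ContinuousAt (radialDeriv r H W m ν) t := by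
  have hd : ∀ {f : ℂ → ℂ}, Differentiable ℂ f → Continuous (deriv f) := fun hf =>
    (hf.contDiff (n := 1)).continuous_deriv le_rfl
  have hl : Continuous fun t : ℝ => (t : ℂ) * ν := Complex.continuous_ofReal.mul continuous_const
  refine ContinuousAt.mul (((hd hp.differentiable_source).comp hl).continuousAt.add
    (tendsto_finsetSum _ fun j _ => ?_)) continuousAt_const
  split_ifs
  · exact ((hd (hp.differentiable j)).comp hl).continuousAt
  · refine (ContinuousAt.mul ?_ ?_).neg
    · exact Complex.continuous_ofReal.continuousAt.comp
        ((continuousAt_const.div continuousAt_id ht.ne').pow 2)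
    · exact (((hd (hp.differentiable j)).comp
        (continuous_fold (hc.radius_succ_pos j))).comp hl).continuousAt

-- The derivative of the row equation. The chain rule factor (r_j/r_i)² is the one the reflection
-- puts into the radial derivative, so `flux_balance` applies again.
omit hc in
theorem deriv_row (i : Fin N) (x : ℂ) :
    ∑ j : Fin N, (if i = j then ((-2 * contrast σ (i + 1) : ℝ) : ℂ) * deriv (W i) x
      else if i < j then (((r (j + 1) / r (i + 1)) ^ 2 : ℝ) : ℂ) *
        deriv (W j) ((((r (j + 1) / r (i + 1)) ^ 2 : ℝ) : ℂ) * x) else -deriv (W j) x) =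
      deriv H x := by
  have h1 := HasDerivAt.fun_sum (u := Finset.univ) (x := x)
    (A := fun (j : Fin N) y => if i = j then ((-2 * contrast σ (i + 1) : ℝ) : ℂ) * W i y
      else if i < j then W j ((((r (j + 1) / r (i + 1)) ^ 2 : ℝ) : ℂ) * y) else -W j y)
    (A' := fun j => if i = j then ((-2 * contrast σ (i + 1) : ℝ) : ℂ) * deriv (W i) x
      else if i < j then (((r (j + 1) / r (i + 1)) ^ 2 : ℝ) : ℂ) *
        deriv (W j) ((((r (j + 1) / r (i + 1)) ^ 2 : ℝ) : ℂ) * x) else -deriv (W j) x)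
    fun j _ => by
      split_ifs
      · exact (hp.differentiable i x).hasDerivAt.const_mul _
      · have h2 := (hp.differentiable j ((((r (j + 1) / r (i + 1)) ^ 2 : ℝ) : ℂ) * x)).hasDerivAt
        have h3 := h2.comp x ((hasDerivAt_id x).const_mul (((r (j + 1) / r (i + 1)) ^ 2 : ℝ) : ℂ))
        rw [mul_one, mul_comm] at h3
        exact h3
      · exact (hp.differentiable j x).hasDerivAt.neg
  simp only [hp.row] at h1
  exact h1.deriv.symm

theorem radialDeriv_balance (i : Fin N) {ν : ℂ} (hν : ‖ν‖ = 1) :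
    (σ i : ℂ) * radialDeriv r H W i ν (r (i + 1)) =
      (σ (i + 1) : ℂ) * radialDeriv r H W (i + 1) ν (r (i + 1)) := by
  set x : ℂ := (r (i + 1) : ℂ) * ν
  have hx : ‖x‖ = r (i + 1) := by
    rw [norm_mul, hν, mul_one, Complex.norm_real,
      Real.norm_of_nonneg (hc.radius_succ_pos i).le]
  have h := flux_balance hc.conductivity_ne i (A := fun j => deriv (W j) x)
    (B := fun j => (((r (j + 1) / r (i + 1)) ^ 2 : ℝ) : ℂ) *
      deriv (W j) ((((r (j + 1) / r (i + 1)) ^ 2 : ℝ) : ℂ) * x))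
    (by simp [div_self (hc.radius_succ_pos i).ne']) (hp.deriv_row i x)
  simp only [radialDeriv, ← mul_assoc]
  congr 1
  convert h using 4 with j _ j _
  · split_ifs with hji
    · rfl
    · rw [fold_of_norm_eq_of_ge hc hx (not_lt.1 hji)]
  · split_ifs with hji
    · rfl
    · rw [fold_of_norm_eq_of_ge hc hx (le_of_lt (not_le.1 (mt Nat.lt_succ_of_le hji)))]

theorem satisfiesTransmission : SatisfiesTransmission N σ r (solution r H W) := by
  intro k hk hkN x hx
  obtain ⟨i, rfl⟩ : ∃ i : Fin N, k = i + 1 := ⟨⟨k - 1, by omega⟩, by simp; omega⟩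
  have hρ := hc.radius_succ_pos i
  set ν := normal x
  have hx0 : x ≠ 0 := norm_pos_iff.1 (hx ▸ hρ)
  have hν : ‖ν‖ = 1 := by
    simp only [ν, normal]
    rw [norm_smul, Real.norm_eq_abs, abs_inv, abs_norm, inv_mul_cancel₀ (norm_ne_zero_iff.2 hx0)]
  have hxν : x = (r (i + 1) : ℂ) * ν := by
    simp only [ν, normal, ← hx, ← Complex.real_smul, smul_smul]
    rw [mul_inv_cancel₀ (norm_ne_zero_iff.2 hx0), one_smul]
  have hplus : ∀ h : ℝ, x + h • ν = ((r (i + 1) + h : ℝ) : ℂ) * ν := fun h => by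
    conv_lhs => rw [hxν]
    rw [Complex.real_smul]; push_cast; ring
  have hminus : ∀ h : ℝ, x - h • ν = ((r (i + 1) - h : ℝ) : ℂ) * ν := fun h => by
    conv_lhs => rw [hxν]
    rw [Complex.real_smul]; push_cast; ring
  have hpos : ∀ᶠ h : ℝ in 𝓝[>] 0, 0 < r (i + 1) + h ∧ 0 < r (i + 1) - h := by
    filter_upwards [Ioo_mem_nhdsGT hρ] with h hh
    exact ⟨by linarith [hh.1], by linarith [hh.2]⟩
  have hto : Tendsto (fun h : ℝ => r (i + 1) + h) (𝓝[>] 0) (𝓝 (r (i + 1))) := by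
    simpa using (tendsto_const_nhds.add tendsto_id).mono_left (nhdsWithin_le_nhds (a := (0 : ℝ)))
  have hti : Tendsto (fun h : ℝ => r (i + 1) - h) (𝓝[>] 0) (𝓝 (r (i + 1))) := by
    simpa using (tendsto_const_nhds.sub tendsto_id).mono_left (nhdsWithin_le_nhds (a := (0 : ℝ)))
  have hnorm : ∀ t : ℝ, 0 < t → ‖(t : ℂ) * ν‖ = t := fun t ht => by
    rw [norm_mul, hν, mul_one, Complex.norm_real, Real.norm_of_nonneg ht.le]
  refine ⟨⟨solution r H W x, ?_, ?_⟩, ?_, radialDeriv r H W i ν (r (i + 1)),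
    radialDeriv r H W (i + 1) ν (r (i + 1)), ?_, ?_, ?_⟩
  · have : Continuous fun h : ℝ => solution r H W (x + h • ν) :=
      (hp.continuous_solution hc).comp (by fun_prop)
    simpa using (this.tendsto 0).mono_left nhdsWithin_le_nhds
  · have : Continuous fun h : ℝ => solution r H W (x - h • ν) :=
      (hp.continuous_solution hc).comp (by fun_prop)
    simpa using (this.tendsto 0).mono_left nhdsWithin_le_nhds
  · filter_upwards [hpos, hc.eventually_isInnerRadius_outer i,
      hc.eventually_isInnerRadius_inner i] with h hh ho hi
    rw [hplus, hminus]
    exact ⟨(hp.hasFDerivAt_solution hc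
        (by rw [hnorm _ hh.1]; exact ho.notMem_radii)).differentiableAt,
      (hp.hasFDerivAt_solution hc (by rw [hnorm _ hh.2]; exact hi.notMem_radii)).differentiableAt⟩
  · refine ((hp.continuousAt_radialDeriv hc i ν hρ).tendsto.comp hto).congr' ?_
    filter_upwards [hpos, hc.eventually_isInnerRadius_outer i] with h hh ho
    rw [hplus, hp.fderiv_solution_radial hc hν hh.1 ho]; rfl
  · refine ((hp.continuousAt_radialDeriv hc (i + 1) ν hρ).tendsto.comp hti).congr' ?_
    filter_upwards [hpos, hc.eventually_isInnerRadius_inner i] with h hh hi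
    rw [hminus, hp.fderiv_solution_radial hc hν hh.2 hi]; rfl
  · exact hp.radialDeriv_balance hc i hν

end IsPotential

/-! ### Power series of the potentials and the scattered field. -/

/-- The sum of the power series `∑_{n ≥ 1} c_n z^n`. -/
noncomputable def powerSum (c : ℕ+ → ℂ) (z : ℂ) : ℂ := ∑' n : ℕ+, c n * z ^ (n : ℕ)

theorem summable_powerSum {c : ℕ+ → ℂ} (hc : ∀ R : ℝ, Summable fun n : ℕ+ => ‖c n‖ * R ^ (n : ℕ))
    (z : ℂ) : Summable fun n : ℕ+ => c n * z ^ (n : ℕ) := by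
  refine Summable.of_norm ?_
  simpa [norm_mul, norm_pow] using hc ‖z‖

theorem differentiable_powerSum {c : ℕ+ → ℂ}
    (hc : ∀ R : ℝ, Summable fun n : ℕ+ => ‖c n‖ * R ^ (n : ℕ)) :
    Differentiable ℂ (powerSum c) := by
  intro z
  have h := Complex.differentiableOn_tsum_of_summable_norm (hc (‖z‖ + 1))
    (F := fun n w => c n * w ^ (n : ℕ)) (U := Metric.ball 0 (‖z‖ + 1))
    (fun n => by fun_prop) Metric.isOpen_ball (fun n w hw => by
      rw [mem_ball_zero_iff] at hw
      rw [norm_mul, norm_pow]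
      gcongr)
  exact h.differentiableAt (Metric.isOpen_ball.mem_nhds (by simp))

theorem powerSum_zero (c : ℕ+ → ℂ) : powerSum c 0 = 0 := by
  simp [powerSum]

theorem norm_pow_mul_exp_arg (x : ℂ) (n : ℕ) :
    (‖x‖ : ℂ) ^ n * Complex.exp ((n : ℂ) * (Complex.arg x : ℂ) * Complex.I) = x ^ n := by
  conv_rhs => rw [← Complex.norm_mul_exp_arg_mul_I x]
  rw [mul_pow, ← Complex.exp_nat_mul, mul_assoc]

variable {N : ℕ} {σ r : ℕ → ℝ} {a : ℕ+ → ℂ}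

/-- The potential attached to the `j`-th interface: its coefficients are `a_n` times the
components of `(𝕄_N^{(n)})⁻¹ e`. -/
noncomputable def potential (N : ℕ) (σ r : ℕ → ℝ) (a : ℕ+ → ℂ) (j : Fin N) : ℂ → ℂ :=
  powerSum fun n => a n * (((gpm N σ r n)⁻¹.mulVec 1 j : ℝ) : ℂ)

theorem IsConfiguration.isUnit_gpm (hc : IsConfiguration N σ r) {n : ℕ} (hn : 1 ≤ n) :
    IsUnit (gpm N σ r n) :=
  ConcentricDisks.isUnit_gpm hc.conductivity_pos hc.conductivity_ne hc.radius_pos hc.radius_lt hn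

theorem IsConfiguration.summable_potential (hc : IsConfiguration N σ r)
    (ha : ∀ R : ℝ, Summable fun n : ℕ+ => ‖a n‖ * R ^ (n : ℕ)) (j : Fin N) (R : ℝ) :
    Summable fun n : ℕ+ => ‖a n * (((gpm N σ r n)⁻¹.mulVec 1 j : ℝ) : ℂ)‖ * R ^ (n : ℕ) := by
  obtain ⟨C, hC⟩ := exists_bound_gpm_inv hc.conductivity_pos hc.conductivity_ne hc.radius_pos
    (fun i j hij => hc.radius_lt_of_lt (by omega) (Nat.succ_lt_succ hij) (by omega)) j
  refine Summable.of_norm_bounded ((ha |R|).mul_left C) fun n => ?_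
  rw [norm_mul, norm_norm, norm_mul, norm_pow, Real.norm_eq_abs, Complex.norm_real,
    Real.norm_eq_abs]
  have := hC n
  calc ‖a n‖ * |(gpm N σ r n)⁻¹.mulVec 1 j| * |R| ^ (n : ℕ) ≤ ‖a n‖ * C * |R| ^ (n : ℕ) := by
        gcongr
    _ = _ := by ring

theorem IsConfiguration.isPotential (hc : IsConfiguration N σ r)
    (ha : ∀ R : ℝ, Summable fun n : ℕ+ => ‖a n‖ * R ^ (n : ℕ)) :
    IsPotential N σ r (powerSum a) (potential N σ r a) where
  differentiable_source := differentiable_powerSum ha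
  differentiable j := differentiable_powerSum (hc.summable_potential ha j)
  map_zero j := powerSum_zero _
  row i x := by
    set w : ℕ+ → Fin N → ℝ := fun n => (gpm N σ r n)⁻¹.mulVec 1
    have hW : ∀ (j : Fin N) (y : ℂ), HasSum (fun n : ℕ+ => a n * (w n j : ℂ) * y ^ (n : ℕ))
        (potential N σ r a j y) := fun j y =>
      (summable_powerSum (hc.summable_potential ha j) y).hasSum
    have hterm : ∀ j : Fin N, HasSum (fun n : ℕ+ => (gpm N σ r n i j : ℂ) * (w n j : ℂ) *
        (a n * x ^ (n : ℕ))) (if i = j then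
          ((-2 * contrast σ (i + 1) : ℝ) : ℂ) * potential N σ r a i x
        else if i < j then potential N σ r a j ((((r (j + 1) / r (i + 1)) ^ 2 : ℝ) : ℂ) * x)
        else -potential N σ r a j x) := by
      intro j
      split_ifs with h1 h2
      · subst h1
        refine ((hW i x).mul_left ((-2 * contrast σ (i + 1) : ℝ) : ℂ)).congr_fun ?_
        intro n
        simp only [gpm, Matrix.of_apply, if_true]
        ring
      · refine (hW j _).congr_fun ?_
        intro n
        simp only [gpm, Matrix.of_apply, if_neg h1, if_pos h2, mul_pow]
        push_cast
        ring
      · refine (hW j x).neg.congr_fun ?_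
        intro n
        simp only [gpm, Matrix.of_apply, if_neg h1, if_neg h2]
        push_cast
        ring
    have hsum := hasSum_sum (s := Finset.univ) fun j _ => hterm j
    refine hsum.unique ((summable_powerSum ha x).hasSum.congr_fun ?_)
    intro n
    have hunit := (Matrix.isUnit_iff_isUnit_det _).1 (hc.isUnit_gpm n.pos)
    -- In degree n, row i of 𝕄⁽ⁿ⁾ applied to (𝕄⁽ⁿ⁾)⁻¹ e gives 1, which leaves a_n xⁿ.
    have h1 : (gpm N σ r n).mulVec (w n) i = 1 := by
      rw [Matrix.mulVec_mulVec, Matrix.mul_nonsing_inv _ hunit, Matrix.one_mulVec, Pi.one_apply]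
    have h2 : ∑ j, (gpm N σ r n i j : ℂ) * (w n j : ℂ) = 1 := by
      exact_mod_cast h1
    rw [← Finset.sum_mul, h2, one_mul]

/-- Beyond r₁ every fold is a reflection and turns the n-th power into r_j²ⁿ e^{inθ}/rⁿ; the factors
r_j²ⁿ form Υ. -/
theorem IsConfiguration.hasSum_scatteredTerm (hc : IsConfiguration N σ r)
    (ha : ∀ R : ℝ, Summable fun n : ℕ+ => ‖a n‖ * R ^ (n : ℕ)) {x : ℂ} (hx : r 1 < ‖x‖) :
    HasSum (scatteredTerm N σ r a x)
      fun j => potential N σ r a j (fold (r (j + 1)) x) := by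
  refine Pi.hasSum.2 fun j => ?_
  have hj : r (j + 1) < ‖x‖ := (hc.radius_le_of_le le_rfl (by omega) (by omega)).trans_lt hx
  have hx0 : (‖x‖ : ℂ) ≠ 0 := by exact_mod_cast ((hc.radius_succ_pos j).trans hj).ne'
  refine (summable_powerSum (hc.summable_potential ha j) (fold (r (j + 1)) x)).hasSum.congr_fun ?_
  intro n
  have h1 : ((upsilon N r n * (gpm N σ r n)⁻¹).map Complex.ofReal).mulVec 1 j =
      ((r (j + 1) ^ (2 * (n : ℕ)) : ℝ) : ℂ) * (((gpm N σ r n)⁻¹.mulVec 1 j : ℝ) : ℂ) := by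
    simp only [upsilon, Matrix.mulVec, dotProduct, Matrix.map_apply, Matrix.diagonal_mul,
      Pi.one_apply, mul_one, Complex.ofReal_sum, Finset.mul_sum, Complex.ofReal_mul]
  rw [scatteredTerm, Pi.smul_apply, h1, smul_eq_mul, fold_of_ge hj.le, mul_pow,
    ← norm_pow_mul_exp_arg x n]
  push_cast
  rw [div_pow, div_pow, ← pow_mul, ← pow_mul]
  field_simp
  ring

end ConcentricDisks

open ConcentricDisks

theorem theorem4p2 (N : ℕ) (hN : 1 ≤ N) (σ r : ℕ → ℝ)
    (hσ0 : σ 0 = 1)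
    (hσ : ∀ k, 1 ≤ k → k ≤ N → 0 < σ k)
    (hσne : ∀ k, 1 ≤ k → k ≤ N → σ k ≠ σ (k - 1))
    (hr : ∀ k, 1 ≤ k → k ≤ N → 0 < r k)
    (hrlt : ∀ k, 1 ≤ k → k < N → r (k + 1) < r k)
    (a : ℕ+ → ℂ) (H : ℂ → ℂ)
    (hH : ∀ x : ℂ, HasSum (fun n : ℕ+ =>
      a n * ((‖x‖ : ℂ) ^ (n : ℕ) * Complex.exp ((n : ℂ) * (Complex.arg x : ℂ) * Complex.I))) (H x)) :
    (∀ n : ℕ, 1 ≤ n → IsUnit (ConcentricDisks.gpm N σ r n)) ∧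
    ∃ u : ℂ → ℂ,
      Continuous u ∧
      ConcentricDisks.SolvesConductivityProblem (ConcentricDisks.conductivity N σ r) H u ∧
      ConcentricDisks.SatisfiesTransmission N σ r u ∧
      (∀ v : ℂ → ℂ,
        ConcentricDisks.SolvesConductivityProblem (ConcentricDisks.conductivity N σ r) H v →
          v =ᵐ[volume] u) ∧
      ∀ x : ℂ, r 1 < ‖x‖ →
        Summable (ConcentricDisks.scatteredTerm N σ r a x) ∧
        u x - H x = (1 : Fin N → ℂ) ⬝ᵥ ∑' n : ℕ+, ConcentricDisks.scatteredTerm N σ r a x n := by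
  have hc : IsConfiguration N σ r := ⟨fun k hk => by
    rcases Nat.eq_zero_or_pos k with rfl | h
    · rw [hσ0]; exact one_pos
    · exact hσ k h hk, hσne, hr, hrlt⟩
  have hH' : ∀ x : ℂ, HasSum (fun n : ℕ+ => a n * x ^ (n : ℕ)) (H x) := fun x =>
    (hH x).congr_fun fun n => by rw [norm_pow_mul_exp_arg]
  -- Summability in ℂ is absolute, so convergence at the real point R controls the whole circle of
  -- radius |R|.
  have ha : ∀ R : ℝ, Summable fun n : ℕ+ => ‖a n‖ * R ^ (n : ℕ) := fun R => by
    refine Summable.of_norm ?_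
    simpa [norm_mul, norm_pow] using (hH' R).summable.norm
  obtain rfl : H = powerSum a := funext fun x => (hH' x).tsum_eq.symm
  have hp := hc.isPotential ha
  obtain ⟨c, C, hc0, hcγ, hC⟩ := hc.exists_conductivity_bounds
  refine ⟨fun n hn => hc.isUnit_gpm hn, solution r (powerSum a) (potential N σ r a),
    hp.continuous_solution hc, hp.solvesConductivityProblem hc, hp.satisfiesTransmission hc,
    fun v hv => (hp.solvesConductivityProblem hc).ae_eq hv
      IsConfiguration.measurable_conductivity hc0 hcγ hC, fun x hx => ?_⟩
  have hs := hc.hasSum_scatteredTerm ha hx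
  refine ⟨hs.summable, ?_⟩
  rw [hs.tsum_eq, one_dotProduct, solution, add_sub_cancel_left]
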